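/- Let $p>2$ be a prime number and let $d>0$ be a square-free integer coprime to $p$ with $d\neq 1,3$. Let $K=\mathbb{Q}(\sqrt{-d})$ with ring of integers $\mathcal{O}_K$, let $G$ be a cyclic group of order $p$, and let $\Lambda=\mathcal{O}_K[G]$. Let $Cl(\Lambda)$ be the class group of stable isomorphism classes of locally free $\Lambda$-modules (the Grothendieck group of locally free $\Lambda$-modules of finite rank under direct sum, modulo the subgroup generated by the class of $\Lambda$), and let $D(\Lambda)$ be the kernel group, i.e. the subgroup of $Cl(\Lambda)$ of classes that become trivial upon extension of scalars to the maximal $\mathcal{O}_K$-order of $K[G]$. Write $C_n$ for the cyclic group of order $n$. Then: (a) if $p$ splits in $K$, i.e. $p\mathcal{O}_K=\mathfrak{p}_1\mathfrak{p}_2$ with distinct prime ideals $\mathfrak{p}_1,\mathfrak{p}_2$, then $D(\Lambda)$ is a homomorphic image of $C_{p-1}$; (b) if $p$ is inert in $K$, i.e. $p\mathcal{O}_K$ is a prime ideal, then $D(\Lambda)$ is isomorphic to $C_{p+1}$ or to $C_{(p+1)/2}$. -/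

import Mathlib

open scoped TensorProduct NumberField

universe u v w

noncomputable section

namespace LocallyFree

/-- The localization `Λ_P` of an `O`-algebra `Λ` at a prime `P` of `O`
(the elements of `O \ P` are inverted). -/
abbrev LocAt (O : Type u) [CommRing O] (A : Type w) [CommRing A] [Algebra O A]
    (P : Ideal O) [P.IsPrime] : Type w :=
  Localization (Algebra.algebraMapSubmonoid A P.primeCompl)

/-- A module `M` over the commutative `O`-algebra `A` is *locally free* (of finite rank) if it is
finitely generated and there is `n` such that `M_P = A_P ⊗ M` is isomorphic to `A_P ^ n` for every
maximal ideal `P` of `O`. -/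
def IsLocallyFree (O : Type u) [CommRing O] (A : Type w) [CommRing A] [Algebra O A]
    (M : Type w) [AddCommGroup M] [Module A M] : Prop :=
  Module.Finite A M ∧ ∃ n : ℕ, ∀ (P : Ideal O) [P.IsMaximal],
    Nonempty ((LocAt O A P ⊗[A] M) ≃ₗ[LocAt O A P] (Fin n → LocAt O A P))

section lemmas

variable (O : Type u) [CommRing O] (A : Type w) [CommRing A] [Algebra O A]

theorem isLocallyFree_pi (n : ℕ) : IsLocallyFree O A (Fin n → A) :=
  ⟨inferInstance, n, fun P _ => ⟨TensorProduct.piScalarRight A (LocAt O A P) (LocAt O A P) (Fin n)⟩⟩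

theorem isLocallyFree_self : IsLocallyFree O A A :=
  ⟨inferInstance, 1, fun P _ =>
    ⟨(TensorProduct.AlgebraTensorModule.rid A (LocAt O A P) (LocAt O A P)).trans
      (LinearEquiv.funUnique (Fin 1) (LocAt O A P) (LocAt O A P)).symm⟩⟩

theorem isLocallyFree_punit : IsLocallyFree O A PUnit.{w + 1} :=
  ⟨inferInstance, 0, fun P _ => by
    have : Subsingleton (LocAt O A P ⊗[A] PUnit.{w + 1}) := inferInstance
    exact ⟨{ (0 : (LocAt O A P ⊗[A] PUnit.{w + 1}) →ₗ[LocAt O A P] (Fin 0 → LocAt O A P)) with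
      invFun := fun _ => 0
      left_inv := fun _ => Subsingleton.elim _ _
      right_inv := fun _ => Subsingleton.elim _ _ }⟩⟩

variable {O A}

theorem IsLocallyFree.prod {M N : Type w} [AddCommGroup M] [Module A M] [AddCommGroup N]
    [Module A N] (hM : IsLocallyFree O A M) (hN : IsLocallyFree O A N) :
    IsLocallyFree O A (M × N) := by
  obtain ⟨hMf, m, hm⟩ := hM
  obtain ⟨hNf, n, hn⟩ := hN
  refine ⟨inferInstance, m + n, fun P _ => ?_⟩
  obtain ⟨e⟩ := hm P
  obtain ⟨f⟩ := hn P
  exact ⟨(TensorProduct.prodRight A (LocAt O A P) (LocAt O A P) M N).trans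
    ((LinearEquiv.prodCongr e f).trans
      ((LinearEquiv.sumArrowLequivProdArrow (Fin m) (Fin n) (LocAt O A P) (LocAt O A P)).symm.trans
        (LinearEquiv.funCongrLeft (LocAt O A P) (LocAt O A P) finSumFinEquiv.symm)))⟩

theorem IsLocallyFree.baseChange {B : Type w} [CommRing B] [Algebra O B] [Algebra A B]
    [IsScalarTower O A B] {M : Type w} [AddCommGroup M] [Module A M]
    (hM : IsLocallyFree O A M) : IsLocallyFree O B (B ⊗[A] M) := by
  obtain ⟨hMf, n, hn⟩ := hM
  refine ⟨inferInstance, n, fun P _ => ?_⟩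
  obtain ⟨e⟩ := hn P
  have hu : ∀ y : Algebra.algebraMapSubmonoid A P.primeCompl,
      IsUnit (algebraMap A (LocAt O B P) y) := by
    rintro ⟨_, r, hr, rfl⟩
    rw [IsScalarTower.algebraMap_apply A B (LocAt O B P)]
    refine IsLocalization.map_units (LocAt O B P)
      (⟨algebraMap A B (algebraMap O A r), r, hr, ?_⟩ : Algebra.algebraMapSubmonoid B P.primeCompl)
    exact (IsScalarTower.algebraMap_apply O A B r)
  let _ : Algebra (LocAt O A P) (LocAt O B P) := (IsLocalization.lift hu).toAlgebra
  have : IsScalarTower A (LocAt O A P) (LocAt O B P) :=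
    IsScalarTower.of_algebraMap_eq fun x => (IsLocalization.lift_eq hu x).symm
  exact ⟨(TensorProduct.AlgebraTensorModule.cancelBaseChange A B (LocAt O B P) (LocAt O B P) M).trans
    ((TensorProduct.AlgebraTensorModule.cancelBaseChange A (LocAt O A P) (LocAt O B P)
      (LocAt O B P) M).symm.trans
    ((e.baseChange (LocAt O A P) (LocAt O B P) _ _).trans
      (TensorProduct.piScalarRight (LocAt O A P) (LocAt O B P) (LocAt O B P) (Fin n))))⟩

end lemmas

/-- A locally free `A`-module (bundled). -/
structure LFMod (O : Type u) [CommRing O] (A : Type w) [CommRing A] [Algebra O A] where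
  carrier : Type w
  [addCommGroup : AddCommGroup carrier]
  [module : Module A carrier]
  isLocallyFree : IsLocallyFree O A carrier

attribute [instance] LFMod.addCommGroup LFMod.module

section classes

variable (O : Type u) [CommRing O] (A : Type w) [CommRing A] [Algebra O A]

/-- Isomorphism of locally free modules. -/
instance LFMod.setoid : Setoid (LFMod O A) where
  r M N := Nonempty (M.carrier ≃ₗ[A] N.carrier)
  iseqv := ⟨fun _ => ⟨LinearEquiv.refl _ _⟩, fun ⟨e⟩ => ⟨e.symm⟩, fun ⟨e⟩ ⟨f⟩ => ⟨e.trans f⟩⟩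

/-- Isomorphism classes of locally free `A`-modules. -/
def IsoClass : Type (w + 1) := Quotient (LFMod.setoid O A)

variable {A} in
/-- The isomorphism class of a locally free module. -/
def IsoClass.mk (M : Type w) [AddCommGroup M] [Module A M] (h : IsLocallyFree O A M) :
    IsoClass O A :=
  Quotient.mk _ ⟨M, h⟩

/-- Addition of isomorphism classes is the direct sum. -/
instance : Add (IsoClass O A) where
  add := Quotient.map₂
    (fun M N => ⟨M.carrier × N.carrier, M.isLocallyFree.prod N.isLocallyFree⟩)
    (fun _ _ ⟨e⟩ _ _ ⟨f⟩ => ⟨LinearEquiv.prodCongr e f⟩)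

instance : Zero (IsoClass O A) where
  zero := IsoClass.mk O PUnit.{w + 1} (isLocallyFree_punit O A)

instance : AddCommMonoid (IsoClass O A) where
  add_assoc := by
    rintro ⟨M⟩ ⟨N⟩ ⟨L⟩
    exact Quotient.sound ⟨LinearEquiv.prodAssoc A M.carrier N.carrier L.carrier⟩
  zero_add := by
    rintro ⟨M⟩
    exact Quotient.sound ⟨LinearEquiv.uniqueProd⟩
  add_zero := by
    rintro ⟨M⟩
    exact Quotient.sound ⟨LinearEquiv.prodUnique⟩
  add_comm := by
    rintro ⟨M⟩ ⟨N⟩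
    exact Quotient.sound ⟨LinearEquiv.prodComm A M.carrier N.carrier⟩
  nsmul := nsmulRec

/-- The class of the free module `A` in the Grothendieck group of locally free modules. -/
def freeClass : Algebra.GrothendieckAddGroup (IsoClass O A) :=
  Algebra.GrothendieckAddGroup.of (IsoClass.mk O A (isLocallyFree_self O A))

/-- The locally free class group `Cl(A)`: the group of stable isomorphism classes of locally free
`A`-modules, i.e. the Grothendieck group of locally free `A`-modules (under direct sum) modulo the
subgroup generated by the class of the free module `A`. -/
abbrev Cl : Type (w + 1) :=
  Algebra.GrothendieckAddGroup (IsoClass O A) ⧸ AddSubgroup.zmultiples (freeClass O A)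

variable (B : Type w) [CommRing B] [Algebra O B] [Algebra A B] [IsScalarTower O A B]

/-- Extension of scalars `M ↦ B ⊗ M` on isomorphism classes of locally free modules. -/
def IsoClass.baseChange : IsoClass O A →+ IsoClass O B where
  toFun := Quotient.map (fun M => ⟨B ⊗[A] M.carrier, M.isLocallyFree.baseChange⟩)
    (fun _ _ ⟨e⟩ => ⟨e.baseChange A B _ _⟩)
  map_zero' := Quotient.sound
    ⟨{ (0 : B ⊗[A] PUnit.{w + 1} →ₗ[B] PUnit.{w + 1}) with
      invFun := fun _ => 0
      left_inv := fun _ => Subsingleton.elim _ _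
      right_inv := fun _ => Subsingleton.elim _ _ }⟩
  map_add' := by
    rintro ⟨M⟩ ⟨N⟩
    exact Quotient.sound ⟨TensorProduct.prodRight A B B M.carrier N.carrier⟩

/-- Extension of scalars on Grothendieck groups. -/
def grothendieckBaseChange : Algebra.GrothendieckAddGroup (IsoClass O A) →+
    Algebra.GrothendieckAddGroup (IsoClass O B) :=
  Algebra.GrothendieckAddGroup.lift
    (Algebra.GrothendieckAddGroup.of.comp (IsoClass.baseChange O A B))

theorem grothendieckBaseChange_of (x : IsoClass O A) :
    grothendieckBaseChange O A B (Algebra.GrothendieckAddGroup.of x) =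
      Algebra.GrothendieckAddGroup.of (IsoClass.baseChange O A B x) :=
  DFunLike.congr_fun (Algebra.GrothendieckAddGroup.lift.symm_apply_apply
    (Algebra.GrothendieckAddGroup.of.comp (IsoClass.baseChange O A B))) x

theorem grothendieckBaseChange_freeClass :
    grothendieckBaseChange O A B (freeClass O A) = freeClass O B := by
  unfold freeClass
  rw [grothendieckBaseChange_of]
  exact congrArg _ (Quotient.sound ⟨TensorProduct.AlgebraTensorModule.rid A B B⟩)

/-- Extension of scalars `Cl(A) → Cl(B)`. -/
def Cl.baseChange : Cl O A →+ Cl O B :=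
  QuotientAddGroup.map _ _ (grothendieckBaseChange O A B) <| by
    rw [AddSubgroup.zmultiples_le]
    exact (grothendieckBaseChange_freeClass O A B).symm ▸ AddSubgroup.mem_zmultiples _

end classes

end LocallyFree

open LocallyFree

section groupRing

/- Below `R` is a domain with field of fractions `F`, such as `R = 𝓞 K` and `F = K`. -/
variable (R : Type u) [CommRing R] (F : Type u) [Field F] [Algebra R F]
  (G : Type v) [CommGroup G]

/-- The maximal `R`-order in the commutative group algebra `F[G]`: the integral closure of `R` in
`F[G]`. -/
abbrev MaximalOrder : Subalgebra R (MonoidAlgebra F G) :=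
  integralClosure R (MonoidAlgebra F G)

variable [Finite G]

theorem isIntegral_mapAlgHom (x : MonoidAlgebra R G) :
    IsIntegral R (MonoidAlgebra.mapAlgHom G (Algebra.ofId R F) x) := by
  suffices h : IsIntegral R x from h.map (MonoidAlgebra.mapAlgHom G (Algebra.ofId R F))
  induction x using MonoidAlgebra.induction_on with
  | of g =>
    refine IsIntegral.of_pow (n := orderOf g) (orderOf_pos g) ?_
    rw [← map_pow, pow_orderOf_eq_one, map_one]
    exact isIntegral_one
  | add a b ha hb => exact ha.add hb
  | smul r a ha => exact ha.smul r

/-- The canonical map from the group ring `R[G]` to the maximal order. -/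
def toMaximalOrder : MonoidAlgebra R G →ₐ[R] MaximalOrder R F G :=
  (MonoidAlgebra.mapAlgHom G (Algebra.ofId R F)).codRestrict _ (isIntegral_mapAlgHom R F G)

instance : Algebra (MonoidAlgebra R G) (MaximalOrder R F G) :=
  (toMaximalOrder R F G).toRingHom.toAlgebra

instance : IsScalarTower R (MonoidAlgebra R G) (MaximalOrder R F G) :=
  IsScalarTower.of_algebraMap_eq fun r => ((toMaximalOrder R F G).commutes r).symm

/-- The kernel group `D(R[G])`: the classes in `Cl(R[G])` that become trivial upon extension of
scalars to the maximal order. -/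
def KernelGroup : AddSubgroup (Cl R (MonoidAlgebra R G)) :=
  (Cl.baseChange R (MonoidAlgebra R G) (MaximalOrder R F G)).ker

end groupRing

end

/-! Write `R` for the ring of integers, `Λ = R[G]`, `N` for the sum of the group elements, `I` for
the augmentation ideal and `J = (N)`. Then `I ∩ J = 0`, `Λ/I ≅ R` and `Λ/(I+J) ≅ R/p`, so `Λ` is the
fibre product of `R` and `Λ/J` over `R/p` (a Milnor square). A unit `u` of `R/p` glues `Λ/I` to
`Λ/J` and gives a locally free module of rank one.

In general (`lineHom_eq_zero_iff`, `range_lineHom`, specialised in `exists_kernelGroup_hom`), `D(Λ)`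
is the quotient of `(R/p)ˣ` by the images of `Rˣ` and `(Λ/J)ˣ`. Modules trivial over the maximal
order come from invertible gluing matrices over `R/p`, which transvections reduce to diagonal ones;
isomorphic gluings are compared through determinants. The maximal order has to map onto both
corners. For `Λ/J`, in essence `R[ζ_p]`, this is `exists_sub_incl_mem_span_normElt`, where `pR`
being radical is essential.

It remains to know the image of the units. Cyclotomic units show that it contains all residues of
integers prime to `p` (`exists_mul_sub_one_mem`). Conversely, the norm of a unit of `Λ/J` down to
`R` is a unit of `R` congruent mod `p` to the `(p-1)`-st power of its residue
(`exists_unit_of_mul_sub_one_mem`). Since `d ≠ 1, 3`, the only units of `R` are `±1`, so the image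
is killed by `2(p-1)`.

If `p` splits, `(R/p)ˣ` is `F_pˣ × F_pˣ` and dividing by the diagonal leaves a quotient of
`C_{p-1}`. If `p` is inert, `(R/p)ˣ` is cyclic of order `(p-1)(p+1)` and the image has order `p-1`
or `2(p-1)`. -/

namespace LocallyFree

/-! ### Locally free modules: projectivity and complements. -/

section general

variable {O : Type u} [CommRing O] {A : Type w} [CommRing A] [Algebra O A]

/-- `A_P` is finite over the local ring `O_P`, so its maximal ideals all lie over the maximal ideal
of `O_P`, and only finitely many primes do. Over such a semilocal ring, constant rank forces a
projective module to be free. -/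
theorem finite_maximalSpectrum_locAt [Module.Finite O A] (P : Ideal O) [P.IsPrime] :
    Finite (MaximalSpectrum (LocAt O A P)) := by
  have hf := Algebra.QuasiFinite.finite_primesOver (S := LocAt O A P)
    (IsLocalRing.maximalIdeal (Localization.AtPrime P))
  have := hf.to_subtype
  refine Finite.of_injective (β := (IsLocalRing.maximalIdeal (Localization.AtPrime P)).primesOver
    (LocAt O A P)) (fun m => ⟨m.asIdeal, m.isMaximal.isPrime, ⟨?_⟩⟩) ?_
  · have := m.isMaximal
    exact (IsLocalRing.eq_maximalIdeal
      (Ideal.isMaximal_comap_of_isIntegral_of_isMaximal m.asIdeal)).symm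
  · intro m n h
    exact MaximalSpectrum.ext (congrArg Subtype.val h)

/-- Projectivity of a finitely presented module is local. A maximal ideal `Q` of `A` contracts to a
maximal `P` of `O` by integrality, and `A_P` maps to `A_Q`, so freeness over `A_P` passes to `A_Q`.
-/
theorem IsLocallyFree.projective [IsNoetherianRing O] [Module.Finite O A] {M : Type w}
    [AddCommGroup M] [Module A M] (hM : IsLocallyFree O A M) : Module.Projective A M := by
  obtain ⟨hMf, n, hn⟩ := hM
  have : IsNoetherianRing A := IsNoetherianRing.of_finite O A
  have : Module.FinitePresentation A M := Module.finitePresentation_of_finite A M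
  refine Module.projective_of_localization_maximal' (fun Q _ => Localization.AtPrime Q)
    (fun Q _ => Localization.AtPrime Q ⊗[A] M)
    (fun Q _ => TensorProduct.mk A (Localization.AtPrime Q) M 1) fun Q hQ => ?_
  have hP : (Q.comap (algebraMap O A)).IsMaximal :=
    Ideal.isMaximal_comap_of_isIntegral_of_isMaximal Q
  obtain ⟨e⟩ := hn (Q.comap (algebraMap O A))
  have hu : ∀ y : Algebra.algebraMapSubmonoid A (Q.comap (algebraMap O A)).primeCompl,
      IsUnit (algebraMap A (Localization.AtPrime Q) y) := by
    rintro ⟨_, r, hr, rfl⟩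
    exact IsLocalization.map_units (Localization.AtPrime Q) (⟨algebraMap O A r, hr⟩ : Q.primeCompl)
  let _ : Algebra (LocAt O A (Q.comap (algebraMap O A))) (Localization.AtPrime Q) :=
    (IsLocalization.lift hu).toAlgebra
  have : IsScalarTower A (LocAt O A (Q.comap (algebraMap O A))) (Localization.AtPrime Q) :=
    IsScalarTower.of_algebraMap_eq fun x => (IsLocalization.lift_eq hu x).symm
  have e' := (TensorProduct.AlgebraTensorModule.cancelBaseChange A
    (LocAt O A (Q.comap (algebraMap O A))) (Localization.AtPrime Q) (Localization.AtPrime Q) M).symm.trans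
    ((e.baseChange (LocAt O A (Q.comap (algebraMap O A))) (Localization.AtPrime Q) _ _).trans
      (TensorProduct.piScalarRight (LocAt O A (Q.comap (algebraMap O A))) (Localization.AtPrime Q)
        (Localization.AtPrime Q) (Fin n)))
  exact Module.Projective.of_equiv e'.symm

theorem exists_prod_equiv_of_projective (M : Type w) [AddCommGroup M] [Module A M]
    [Module.Finite A M] [Module.Projective A M] :
    ∃ (n : ℕ) (Y : Submodule A (Fin n → A)), Nonempty ((M × Y) ≃ₗ[A] (Fin n → A)) := by
  obtain ⟨n, f, hf⟩ := Module.Finite.exists_fin' A M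
  obtain ⟨s, hs⟩ := Module.projective_lifting_property f LinearMap.id hf
  have hs' : ∀ x, f (s x) = x := fun x => LinearMap.congr_fun hs x
  refine ⟨n, LinearMap.ker f, ⟨LinearEquiv.ofBijective
    (s.coprod (LinearMap.ker f).subtype) ⟨?_, ?_⟩⟩⟩
  · rw [← LinearMap.ker_eq_bot, LinearMap.ker_eq_bot']
    rintro ⟨x, y⟩ h
    simp only [LinearMap.coprod_apply, Submodule.subtype_apply] at h
    have h1 : x = 0 := by
      have := congrArg f h
      rwa [map_add, hs', LinearMap.mem_ker.1 y.2, add_zero, map_zero] at this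
    subst h1
    rw [map_zero, zero_add] at h
    exact Prod.ext rfl (Subtype.ext h)
  · intro z
    refine ⟨(f z, ⟨z - s (f z), ?_⟩), ?_⟩
    · rw [LinearMap.mem_ker, map_sub, hs', sub_self]
    · simp

/-- Counting dimensions over each residue field of `A_P` shows that the projective module `N_P` has
constant rank `n - r`; over the semilocal ring `A_P` it is therefore free. -/
theorem isLocallyFree_of_prod [Module.Finite O A] {M N : Type w} [AddCommGroup M] [Module A M]
    [AddCommGroup N] [Module A N] (hM : IsLocallyFree O A M) {n : ℕ}
    (e : (M × N) ≃ₗ[A] (Fin n → A)) : IsLocallyFree O A N := by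
  have hNf : Module.Finite A N :=
    Module.Finite.of_surjective ((LinearMap.snd A M N).comp e.symm.toLinearMap)
      ((LinearMap.snd_surjective (R := A) (M := M) (M₂ := N)).comp e.symm.surjective)
  have hMp : Module.Projective A N := by
    have h : ((LinearMap.snd A M N).comp e.symm.toLinearMap).comp
        (e.toLinearMap.comp (LinearMap.inr A M N)) = LinearMap.id := by
      ext x
      simp
    exact Module.Projective.of_split _ _ h
  obtain ⟨hMf, r, hr⟩ := hM
  refine ⟨hNf, n - r, fun P _ => ?_⟩
  obtain ⟨f⟩ := hr P
  have := finite_maximalSpectrum_locAt (A := A) P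
  obtain ⟨b⟩ := Module.nonempty_basis_of_flat_of_finrank_eq (LocAt O A P) (LocAt O A P ⊗[A] N)
    (n - r) fun Q => by
      let _ := Ideal.Quotient.field Q.1
      let L := LocAt O A P
      have eL : ((L ⊗[A] M) × (L ⊗[A] N)) ≃ₗ[L] (Fin n → L) :=
        (TensorProduct.prodRight A L L M N).symm.trans
          ((e.baseChange A L _ _).trans (TensorProduct.piScalarRight A L L (Fin n)))
      have eQ : (((L ⧸ Q.1) ⊗[L] (L ⊗[A] M)) × ((L ⧸ Q.1) ⊗[L] (L ⊗[A] N))) ≃ₗ[L ⧸ Q.1]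
          (Fin n → L ⧸ Q.1) :=
        (TensorProduct.prodRight L (L ⧸ Q.1) (L ⧸ Q.1) _ _).symm.trans
          ((eL.baseChange L (L ⧸ Q.1) _ _).trans
            (TensorProduct.piScalarRight L (L ⧸ Q.1) (L ⧸ Q.1) (Fin n)))
      have eM : ((L ⧸ Q.1) ⊗[L] (L ⊗[A] M)) ≃ₗ[L ⧸ Q.1] (Fin r → L ⧸ Q.1) :=
        (f.baseChange L (L ⧸ Q.1) _ _).trans
          (TensorProduct.piScalarRight L (L ⧸ Q.1) (L ⧸ Q.1) (Fin r))
      have h1 := eQ.finrank_eq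
      rw [Module.finrank_prod, eM.finrank_eq, Module.finrank_fin_fun, Module.finrank_fin_fun] at h1
      exact Nat.eq_sub_of_add_eq' h1
  exact ⟨b.equivFun⟩

theorem IsLocallyFree.exists_complement [IsNoetherianRing O] [Module.Finite O A] {M : Type w}
    [AddCommGroup M] [Module A M] (hM : IsLocallyFree O A M) :
    ∃ (n : ℕ) (Y : Submodule A (Fin n → A)), IsLocallyFree O A Y ∧
      Nonempty ((M × Y) ≃ₗ[A] (Fin n → A)) := by
  have := hM.1
  have := hM.projective
  obtain ⟨n, Y, ⟨e⟩⟩ := exists_prod_equiv_of_projective (A := A) M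
  exact ⟨n, Y, isLocallyFree_of_prod hM e, ⟨e⟩⟩

theorem IsLocallyFree.congr {M N : Type w} [AddCommGroup M] [Module A M] [AddCommGroup N]
    [Module A N] (hM : IsLocallyFree O A M) (e : M ≃ₗ[A] N) : IsLocallyFree O A N := by
  obtain ⟨hMf, n, hn⟩ := hM
  refine ⟨Module.Finite.equiv e, n, fun P _ => ?_⟩
  obtain ⟨f⟩ := hn P
  exact ⟨(e.baseChange A (LocAt O A P) _ _).symm.trans f⟩

theorem IsLocallyFree.pi_fin {n : ℕ} {M : Fin n → Type w} [∀ i, AddCommGroup (M i)]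
    [∀ i, Module A (M i)] (hM : ∀ i, IsLocallyFree O A (M i)) :
    IsLocallyFree O A (∀ i, M i) := by
  induction n with
  | zero =>
    exact IsLocallyFree.congr (isLocallyFree_punit O A)
      (0 : PUnit.{w + 1} ≃ₗ[A] (∀ i : Fin 0, M i))
  | succ n ih =>
    exact ((hM 0).prod (ih fun i => hM i.succ)).congr (Fin.consLinearEquiv A M)

end general

/-! ### Classes in the locally free class group. -/

section cls

variable (O : Type u) [CommRing O] {A : Type w} [CommRing A] [Algebra O A]

/-- The class of a locally free module in the class group. -/
def cls (M : Type w) [AddCommGroup M] [Module A M] (h : IsLocallyFree O A M) : Cl O A :=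
  QuotientAddGroup.mk (Algebra.GrothendieckAddGroup.of (IsoClass.mk O M h))

variable {O} {M N : Type w} [AddCommGroup M] [Module A M] [AddCommGroup N] [Module A N]

theorem cls_congr (hM : IsLocallyFree O A M) (hN : IsLocallyFree O A N) (e : M ≃ₗ[A] N) :
    cls O M hM = cls O N hN := by
  unfold cls
  rw [show IsoClass.mk O M hM = IsoClass.mk O N hN from Quotient.sound ⟨e⟩]

theorem cls_prod (hM : IsLocallyFree O A M) (hN : IsLocallyFree O A N) :
    cls O (M × N) (hM.prod hN) = cls O M hM + cls O N hN := by
  unfold cls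
  rw [← QuotientAddGroup.mk_add, ← map_add]
  rfl

theorem cls_self : cls O A (isLocallyFree_self O A) = 0 :=
  (QuotientAddGroup.eq_zero_iff _).2 (AddSubgroup.mem_zmultiples _)

theorem cls_subsingleton [Subsingleton M] (hM : IsLocallyFree O A M) : cls O M hM = 0 := by
  have := cls_prod hM hM
  have e : M ≃ₗ[A] (M × M) := 0
  rwa [← cls_congr hM _ e, left_eq_add] at this

theorem cls_pi_fin {n : ℕ} {M : Fin n → Type w} [∀ i, AddCommGroup (M i)]
    [∀ i, Module A (M i)] (hM : ∀ i, IsLocallyFree O A (M i)) :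
    cls O (∀ i, M i) (.pi_fin hM) = ∑ i, cls O (M i) (hM i) := by
  induction n with
  | zero => exact cls_subsingleton _
  | succ n ih =>
    rw [Fin.sum_univ_succ, ← ih, ← cls_prod]
    exact (cls_congr _ _ (Fin.consLinearEquiv A M)).symm

theorem cls_pi (n : ℕ) : cls O (Fin n → A) (isLocallyFree_pi O A n) = 0 := by
  have := cls_pi_fin (O := O) (M := fun _ : Fin n => A) fun _ => isLocallyFree_self O A
  rw [Finset.sum_eq_zero fun i _ => cls_self] at this
  exact this

/-- A formal difference `[M] - [N]` becomes `[M × Y]` once `N × Y` is free, because free modules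
have class zero. -/
theorem exists_cls_eq [IsNoetherianRing O] [Module.Finite O A] (z : Cl O A) :
    ∃ (M : Type w) (_ : AddCommGroup M) (_ : Module A M) (h : IsLocallyFree O A M),
      z = cls O M h := by
  obtain ⟨x, rfl⟩ := QuotientAddGroup.mk_surjective z
  induction x using AddLocalization.ind with | _ x
  obtain ⟨a, b, -⟩ := x
  obtain ⟨⟨M, hM⟩, rfl⟩ := Quotient.exists_rep a
  obtain ⟨⟨N, hN⟩, rfl⟩ := Quotient.exists_rep b
  obtain ⟨n, Y, hY, ⟨e⟩⟩ := hN.exists_complement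
  refine ⟨M × Y, inferInstance, inferInstance, hM.prod hY, ?_⟩
  have h1 : cls O N hN + cls O Y hY = 0 := by
    rw [← cls_prod hN hY, cls_congr _ (isLocallyFree_pi O A n) e, cls_pi]
  rw [cls_prod hM hY, eq_neg_of_add_eq_zero_right h1, ← sub_eq_add_neg]
  unfold cls
  rw [← QuotientAddGroup.mk_sub]
  congr 1
  rw [AddLocalization.mk_eq_addMonoidOf_mk', eq_sub_iff_add_eq]
  exact AddSubmonoid.LocalizationMap.mk'_spec _ _ _

theorem of_eq_of_iff {x y : IsoClass O A} :
    Algebra.GrothendieckAddGroup.of x = Algebra.GrothendieckAddGroup.of y ↔ ∃ z, z + x = z + y := by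
  refine (AddSubmonoid.LocalizationMap.eq_iff_exists (AddLocalization.addMonoidOf ⊤)).trans ?_
  exact ⟨fun ⟨c, h⟩ => ⟨c, h⟩, fun ⟨c, h⟩ => ⟨⟨c, trivial⟩, h⟩⟩

theorem nsmul_isoClass_self (n : ℕ) :
    n • IsoClass.mk O A (isLocallyFree_self O A) = IsoClass.mk O (Fin n → A) (isLocallyFree_pi O A n) := by
  induction n with
  | zero =>
    rw [zero_nsmul]
    exact Quotient.sound ⟨(0 : PUnit.{w + 1} ≃ₗ[A] (Fin 0 → A))⟩
  | succ n ih =>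
    rw [succ_nsmul', ih]
    exact Quotient.sound ⟨Fin.consLinearEquiv A fun _ => A⟩

/-- Equality in a Grothendieck group means isomorphism after adding some common `Z`. Adding a
complement of `Z` as well makes the common summand free, so triviality of the class is stable
freeness. -/
theorem exists_equiv_of_cls_eq_zero [IsNoetherianRing O] [Module.Finite O A]
    {hM : IsLocallyFree O A M} (h : cls O M hM = 0) :
    ∃ a b : ℕ, Nonempty ((M × (Fin a → A)) ≃ₗ[A] (Fin b → A)) := by
  obtain ⟨k, hk⟩ := AddSubgroup.mem_zmultiples_iff.1 ((QuotientAddGroup.eq_zero_iff _).1 h)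
  -- The multiple `k` of the free class may be negative; its two parts are placed on opposite sides.
  obtain ⟨a, b, rfl⟩ : ∃ a b : ℕ, k = (b : ℤ) - a := ⟨(-k).toNat, k.toNat, by omega⟩
  have h2 : Algebra.GrothendieckAddGroup.of (IsoClass.mk O M hM + IsoClass.mk O _ (isLocallyFree_pi O A a))
      = Algebra.GrothendieckAddGroup.of (IsoClass.mk O _ (isLocallyFree_pi O A b)) := by
    rw [map_add, ← hk, ← nsmul_isoClass_self, ← nsmul_isoClass_self, map_nsmul, map_nsmul,
      sub_zsmul, natCast_zsmul, natCast_zsmul]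
    exact sub_add_cancel _ _
  obtain ⟨z, hz⟩ := of_eq_of_iff.1 h2
  obtain ⟨⟨Z, hZ⟩, rfl⟩ := Quotient.exists_rep z
  obtain ⟨e⟩ : Nonempty ((Z × (M × (Fin a → A))) ≃ₗ[A] (Z × (Fin b → A))) := Quotient.exact hz
  obtain ⟨n, Y, -, ⟨f⟩⟩ := hZ.exists_complement
  have f' : (Y × Z) ≃ₗ[A] (Fin n → A) := (LinearEquiv.prodComm A _ _).trans f
  have pi_add : ∀ i j : ℕ, Nonempty (((Fin i → A) × (Fin j → A)) ≃ₗ[A] (Fin (i + j) → A)) :=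
    fun i j => ⟨(LinearEquiv.sumArrowLequivProdArrow (Fin i) (Fin j) A A).symm.trans
      (LinearEquiv.funCongrLeft A A finSumFinEquiv.symm)⟩
  obtain ⟨p1⟩ := pi_add n a
  obtain ⟨p2⟩ := pi_add n b
  let comm : (M × ((Fin n → A) × (Fin a → A))) ≃ₗ[A] ((Fin n → A) × (M × (Fin a → A))) :=
    ((LinearEquiv.prodAssoc A _ _ _).symm.trans
      (LinearEquiv.prodCongr (LinearEquiv.prodComm A _ _) (LinearEquiv.refl A _))).trans
        (LinearEquiv.prodAssoc A _ _ _)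
  let q : ((Fin n → A) × (M × (Fin a → A))) ≃ₗ[A] ((Fin n → A) × (Fin b → A)) := (LinearEquiv.prodCongr f'.symm (LinearEquiv.refl A (M × (Fin a → A)))).trans
    ((LinearEquiv.prodAssoc A Y Z _).trans ((LinearEquiv.prodCongr (LinearEquiv.refl A Y) e).trans
      ((LinearEquiv.prodAssoc A Y Z _).symm.trans
        (LinearEquiv.prodCongr f' (LinearEquiv.refl A (Fin b → A))))))
  exact ⟨n + a, n + b, ⟨(LinearEquiv.prodCongr (LinearEquiv.refl A M) p1.symm).trans
    (comm.trans (q.trans p2))⟩⟩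

variable (B : Type w) [CommRing B] [Algebra O B] [Algebra A B] [IsScalarTower O A B]

theorem baseChange_cls (hM : IsLocallyFree O A M) :
    Cl.baseChange O A B (cls O M hM) = cls O (B ⊗[A] M) hM.baseChange := by
  unfold Cl.baseChange cls
  rw [QuotientAddGroup.map_mk, grothendieckBaseChange_of]
  rfl

end cls

end LocallyFree

/-! ### Matrices generated by transvections. -/

section transvections

open Matrix

variable {n : Type*} [DecidableEq n]

theorem map_transvection {A B : Type*} [CommRing A] [CommRing B] (f : A →+* B) (i j : n) (c : A) :
    (transvection i j c).map f = transvection i j (f c) := by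
  ext a b
  simp only [transvection, Matrix.map_apply, Matrix.add_apply, map_add, Matrix.single_apply,
    Matrix.one_apply]
  split_ifs <;> simp

variable [Fintype n]

/-- The submonoid of matrices generated by the transvections. -/
def transvectionMonoid (n : Type*) [DecidableEq n] [Fintype n] (A : Type*) [CommRing A] :
    Submonoid (Matrix n n A) :=
  Submonoid.closure {M | ∃ (i j : n) (c : A), i ≠ j ∧ M = transvection i j c}

theorem transvection_mem_transvectionMonoid {A : Type*} [CommRing A] {i j : n} (h : i ≠ j) (c : A) :
    transvection i j c ∈ transvectionMonoid n A :=
  Submonoid.subset_closure ⟨i, j, c, h, rfl⟩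

/-- Invertible matrices need not lift along a surjection, but a transvection does: lift its single
parameter. This makes transvections harmless in gluing matrices. -/
theorem exists_lift_of_mem_transvectionMonoid {A B : Type*} [CommRing A] [CommRing B] {f : A →+* B}
    (hf : Function.Surjective f) {M : Matrix n n B} (hM : M ∈ transvectionMonoid n B) :
    ∃ N : (Matrix n n A)ˣ, (N : Matrix n n A).map f = M := by
  induction hM using Submonoid.closure_induction with
  | mem M h =>
    obtain ⟨i, j, c, hij, rfl⟩ := h
    obtain ⟨c, rfl⟩ := hf c
    have h : IsUnit (transvection i j c) := by
      rw [Matrix.isUnit_iff_isUnit_det, det_transvection_of_ne i j hij]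
      exact isUnit_one
    exact ⟨h.unit, map_transvection f i j c⟩
  | one => exact ⟨1, by simp [Matrix.map_one]⟩
  | mul x y _ _ hx hy =>
    obtain ⟨N, rfl⟩ := hx
    obtain ⟨N', rfl⟩ := hy
    exact ⟨N * N', by simp [Matrix.map_mul]⟩

theorem map_mem_transvectionMonoid {A B : Type*} [CommRing A] [CommRing B] (f : A →+* B)
    {M : Matrix n n A} (hM : M ∈ transvectionMonoid n A) : M.map f ∈ transvectionMonoid n B := by
  have : transvectionMonoid n A ≤ (transvectionMonoid n B).comap 
      (f.mapMatrix (m := n)).toMonoidHom := by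
    refine Submonoid.closure_le.2 ?_
    rintro _ ⟨i, j, c, hij, rfl⟩
    change (transvection i j c).map f ∈ transvectionMonoid n B
    rw [map_transvection]
    exact transvection_mem_transvectionMonoid hij _
  exact this hM

/-- Every square matrix over `A` becomes diagonal after multiplying by transvections on the left and
on the right. -/
def IsDiagonalizableByTransvections (A : Type*) [CommRing A] : Prop :=
  ∀ (n : ℕ) (g : Matrix (Fin n) (Fin n) A), ∃ L ∈ transvectionMonoid (Fin n) A,
    ∃ L' ∈ transvectionMonoid (Fin n) A, ∃ d : Fin n → A, g = L * diagonal d * L'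

theorem TransvectionStruct.list_prod_mem {A : Type*} [CommRing A]
    (l : List (TransvectionStruct n A)) :
    (l.map TransvectionStruct.toMatrix).prod ∈ transvectionMonoid n A := by
  refine Submonoid.list_prod_mem _ fun M hM => ?_
  obtain ⟨t, -, rfl⟩ := List.mem_map.1 hM
  exact transvection_mem_transvectionMonoid t.hij t.c

theorem isDiagonalizableByTransvections_field (F : Type*) [Field F] :
    IsDiagonalizableByTransvections F := by
  intro n g
  obtain ⟨L, L', d, h⟩ := Pivot.exists_list_transvec_mul_diagonal_mul_list_transvec g
  exact ⟨_, TransvectionStruct.list_prod_mem L, _, TransvectionStruct.list_prod_mem L', d, h⟩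

theorem IsDiagonalizableByTransvections.of_surjective {A B : Type*} [CommRing A] [CommRing B]
    (hA : IsDiagonalizableByTransvections A) (f : A →+* B) (hf : Function.Surjective f) :
    IsDiagonalizableByTransvections B := by
  intro n g
  choose s hs using hf
  obtain ⟨L, hL, L', hL', d, h⟩ := hA n (g.map s)
  refine ⟨_, map_mem_transvectionMonoid f hL, _, map_mem_transvectionMonoid f hL', f ∘ d, ?_⟩
  have h1 : g = (g.map s).map f := by
    ext i j
    simp [hs]
  rw [h1, h, Matrix.map_mul, Matrix.map_mul, Matrix.diagonal_map (map_zero f)]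
  rfl

/-- A transvection with parameter `(c, 0)` or `(0, c)` acts on one factor only, so the two
reductions can be performed independently. -/
theorem IsDiagonalizableByTransvections.prod {A B : Type*} [CommRing A] [CommRing B]
    (hA : IsDiagonalizableByTransvections A) (hB : IsDiagonalizableByTransvections B) :
    IsDiagonalizableByTransvections (A × B) := by
  intro n g
  have ext' : ∀ M N : Matrix (Fin n) (Fin n) (A × B), M.map (RingHom.fst A B) = N.map (RingHom.fst A B) →
      M.map (RingHom.snd A B) = N.map (RingHom.snd A B) → M = N := fun M N h1 h2 => by
    ext i j
    · exact congrFun (congrFun h1 i) j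
    · exact congrFun (congrFun h2 i) j
  have lift : ∀ L ∈ transvectionMonoid (Fin n) A, ∀ K ∈ transvectionMonoid (Fin n) B,
      ∃ M ∈ transvectionMonoid (Fin n) (A × B), M.map (RingHom.fst A B) = L ∧
        M.map (RingHom.snd A B) = K := by
    intro L hL K hK
    have h1 : ∃ M ∈ transvectionMonoid (Fin n) (A × B), M.map (RingHom.fst A B) = L ∧
        M.map (RingHom.snd A B) = 1 := by
      induction hL using Submonoid.closure_induction with
      | mem M h =>
        obtain ⟨i, j, c, hij, rfl⟩ := h
        refine ⟨_, transvection_mem_transvectionMonoid hij (c, 0), ?_, ?_⟩ <;> rw [map_transvection] <;>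
          simp [transvection_zero]
      | one => exact ⟨1, one_mem _, by simp [Matrix.map_one], by simp [Matrix.map_one]⟩
      | mul x y _ _ hx hy =>
        obtain ⟨M, hM, rfl, h2⟩ := hx
        obtain ⟨N, hN, rfl, h3⟩ := hy
        exact ⟨M * N, mul_mem hM hN, by rw [Matrix.map_mul], by rw [Matrix.map_mul, h2, h3, one_mul]⟩
    have h2' : ∃ M ∈ transvectionMonoid (Fin n) (A × B), M.map (RingHom.fst A B) = 1 ∧
        M.map (RingHom.snd A B) = K := by
      induction hK using Submonoid.closure_induction with
      | mem M h =>
        obtain ⟨i, j, c, hij, rfl⟩ := h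
        refine ⟨_, transvection_mem_transvectionMonoid hij (0, c), ?_, ?_⟩ <;> rw [map_transvection] <;>
          simp [transvection_zero]
      | one => exact ⟨1, one_mem _, by simp [Matrix.map_one], by simp [Matrix.map_one]⟩
      | mul x y _ _ hx hy =>
        obtain ⟨M, hM, h2, rfl⟩ := hx
        obtain ⟨N, hN, h3, rfl⟩ := hy
        exact ⟨M * N, mul_mem hM hN, by rw [Matrix.map_mul, h2, h3, one_mul], by rw [Matrix.map_mul]⟩
    obtain ⟨M, hM, rfl, h2⟩ := h1
    obtain ⟨N, hN, h3, h4⟩ := h2'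
    exact ⟨M * N, mul_mem hM hN, by rw [Matrix.map_mul, h3, mul_one],
      by rw [Matrix.map_mul, h2, one_mul, h4]⟩
  obtain ⟨L, hL, L', hL', d, h⟩ := hA n (g.map (RingHom.fst A B))
  obtain ⟨K, hK, K', hK', c, h'⟩ := hB n (g.map (RingHom.snd A B))
  obtain ⟨M, hM, h1, h2⟩ := lift L hL K hK
  obtain ⟨M', hM', h3, h4⟩ := lift L' hL' K' hK'
  refine ⟨M, hM, M', hM', fun i => (d i, c i), ext' _ _ ?_ ?_⟩
  · rw [h, Matrix.map_mul, Matrix.map_mul, h1, h3, Matrix.diagonal_map (map_zero _)]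
    rfl
  · rw [h', Matrix.map_mul, Matrix.map_mul, h2, h4, Matrix.diagonal_map (map_zero _)]
    rfl

/-- Whitehead's identity. It is what makes the class of a rank-one gluing multiplicative in the
gluing unit. -/
theorem diagonal_mem_transvectionMonoid {A : Type*} [CommRing A] {a b : A} (h : a * b = 1) :
    diagonal ![a, b] ∈ transvectionMonoid (Fin 2) A := by
  have h01 : (0 : Fin 2) ≠ 1 := by decide
  have h10 : (1 : Fin 2) ≠ 0 := by decide
  have key : diagonal ![a, b] = transvection 0 1 a * transvection 1 0 (-b) * transvection 0 1 a *
      (transvection 0 1 (-1) * transvection 1 0 1 * transvection 0 1 (-1)) := by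
    have h' : b * a = 1 := by rw [mul_comm, h]
    ext i j
    fin_cases i <;> fin_cases j <;>
      simp [transvection, Matrix.mul_apply, Fin.sum_univ_two, Matrix.single_apply, h, h']
  rw [key]
  have t01 := fun c : A => transvection_mem_transvectionMonoid h01 c
  have t10 := fun c : A => transvection_mem_transvectionMonoid h10 c
  exact mul_mem (mul_mem (mul_mem (t01 _) (t10 _)) (t01 _)) (mul_mem (mul_mem (t01 _) (t10 _)) (t01 _))

end transvections

/-! ### Gluing free modules over a Milnor square. -/

noncomputable section

namespace MilnorSquare

open Matrix LocallyFree

variable {Λ : Type w} [CommRing Λ] (I J : Ideal Λ)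

/-- The projection `Λ / I → Λ / (I + J)`. -/
abbrev projLeft : (Λ ⧸ I) →ₐ[Λ] (Λ ⧸ (I ⊔ J)) := Ideal.Quotient.factorₐ Λ le_sup_left

/-- The projection `Λ / J → Λ / (I + J)`. -/
abbrev projRight : (Λ ⧸ J) →ₐ[Λ] (Λ ⧸ (I ⊔ J)) := Ideal.Quotient.factorₐ Λ le_sup_right

theorem projLeft_surjective : Function.Surjective (projLeft I J) :=
  Ideal.Quotient.factor_surjective le_sup_left

theorem projRight_surjective : Function.Surjective (projRight I J) :=
  Ideal.Quotient.factor_surjective le_sup_right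

variable {I J}

theorem exists_eq_of_proj_eq {a : Λ ⧸ I} {b : Λ ⧸ J} (h : projLeft I J a = projRight I J b) :
    ∃ c : Λ, Ideal.Quotient.mk I c = a ∧ Ideal.Quotient.mk J c = b := by
  obtain ⟨x, rfl⟩ := Ideal.Quotient.mk_surjective a
  obtain ⟨y, rfl⟩ := Ideal.Quotient.mk_surjective b
  obtain ⟨i, hi, j, hj, hij⟩ := Submodule.mem_sup.1 (Ideal.Quotient.eq.1
    (show Ideal.Quotient.mk (I ⊔ J) x = Ideal.Quotient.mk (I ⊔ J) y from h))
  refine ⟨x - i, ?_, ?_⟩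
  · rw [Ideal.Quotient.eq]
    simpa using hi
  · rw [Ideal.Quotient.eq, show x - i - y = j by linear_combination -hij]
    exact hj

variable {ι : Type} [Fintype ι]

/-- The module obtained by gluing `(Λ / I) ^ ι` and `(Λ / J) ^ ι` along the matrix `g` over
`Λ / (I + J)`. -/
def glue (g : Matrix ι ι (Λ ⧸ (I ⊔ J))) : Submodule Λ ((ι → Λ ⧸ I) × (ι → Λ ⧸ J)) where
  carrier := {x | g *ᵥ (projLeft I J ∘ x.1) = projRight I J ∘ x.2}
  add_mem' {x y} hx hy := by
    have h1 : projLeft I J ∘ (x + y).1 = projLeft I J ∘ x.1 + projLeft I J ∘ y.1 := by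
      ext i; simp
    have h2 : projRight I J ∘ (x + y).2 = projRight I J ∘ x.2 + projRight I J ∘ y.2 := by
      ext i; simp
    simp only [Set.mem_ofPred_eq] at hx hy ⊢
    rw [h1, h2, mulVec_add, hx, hy]
  zero_mem' := by
    have h1 : projLeft I J ∘ (0 : (ι → Λ ⧸ I) × (ι → Λ ⧸ J)).1 = 0 := by ext i; simp
    have h2 : projRight I J ∘ (0 : (ι → Λ ⧸ I) × (ι → Λ ⧸ J)).2 = 0 := by ext i; simp
    simp only [Set.mem_ofPred_eq]
    rw [h1, h2, mulVec_zero]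
  smul_mem' c x hx := by
    have h1 : projLeft I J ∘ (c • x).1 = c • (projLeft I J ∘ x.1) := by ext i; simp
    have h2 : projRight I J ∘ (c • x).2 = c • (projRight I J ∘ x.2) := by ext i; simp
    simp only [Set.mem_ofPred_eq] at hx ⊢
    rw [h1, h2, mulVec_smul, hx]

theorem mem_glue {g : Matrix ι ι (Λ ⧸ (I ⊔ J))} {x : (ι → Λ ⧸ I) × (ι → Λ ⧸ J)} :
    x ∈ glue g ↔ g *ᵥ (projLeft I J ∘ x.1) = projRight I J ∘ x.2 := Iff.rfl

/-- The submodule of `(Λ / I) × (Λ / J)` of pairs whose images in `Λ / (I + J)` differ by the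
factor `u`. -/
def line (u : Λ ⧸ (I ⊔ J)) : Submodule Λ ((Λ ⧸ I) × (Λ ⧸ J)) where
  carrier := {x | u * projLeft I J x.1 = projRight I J x.2}
  add_mem' {x y} hx hy := by
    simp only [Set.mem_ofPred_eq, Prod.fst_add, Prod.snd_add, map_add] at hx hy ⊢
    rw [mul_add, hx, hy]
  zero_mem' := by simp
  smul_mem' c x hx := by
    simp only [Set.mem_ofPred_eq, Prod.smul_fst, Prod.smul_snd, map_smul] at hx ⊢
    rw [mul_smul_comm, hx]

theorem mem_line {u : Λ ⧸ (I ⊔ J)} {x : (Λ ⧸ I) × (Λ ⧸ J)} :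
    x ∈ line u ↔ u * projLeft I J x.1 = projRight I J x.2 := Iff.rfl

variable [DecidableEq ι]

/-- Gluing along a diagonal matrix gives a product of modules of rank one. -/
def glueDiagonal (d : ι → Λ ⧸ (I ⊔ J)) : glue (diagonal d) ≃ₗ[Λ] (∀ i, line (d i)) where
  toFun x i := ⟨(x.1.1 i, x.1.2 i), by
    have := congrFun (mem_glue.1 x.2) i
    rwa [mulVec_diagonal] at this⟩
  map_add' _ _ := rfl
  map_smul' _ _ := rfl
  invFun y := ⟨(fun i => (y i).1.1, fun i => (y i).1.2), by
    rw [mem_glue]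
    ext i
    rw [mulVec_diagonal]
    exact (y i).2⟩
  left_inv _ := rfl
  right_inv _ := rfl

/-- `Λ` is the fibre product of `Λ / I` and `Λ / J` over `Λ / (I + J)` if `I ∩ J = 0`. -/
def lineOne (h : I ⊓ J = ⊥) : Λ ≃ₗ[Λ] line (1 : Λ ⧸ (I ⊔ J)) :=
  LinearEquiv.ofBijective
    (((Submodule.mkQ I).prod (Submodule.mkQ J)).codRestrict (line 1) fun c => by
      rw [mem_line, one_mul]; rfl) <| by
    constructor
    · rw [← LinearMap.ker_eq_bot, LinearMap.ker_eq_bot']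
      intro c hc
      have hc' := congrArg Subtype.val hc
      have h1 : c ∈ I := (Submodule.Quotient.mk_eq_zero I).1 (congrArg Prod.fst hc')
      have h2 : c ∈ J := (Submodule.Quotient.mk_eq_zero J).1 (congrArg Prod.snd hc')
      have : c ∈ I ⊓ J := ⟨h1, h2⟩
      rwa [h] at this
    · rintro ⟨⟨a, b⟩, hab⟩
      rw [mem_line, one_mul] at hab
      obtain ⟨c, h1, h2⟩ := exists_eq_of_proj_eq hab
      exact ⟨c, Subtype.ext (Prod.ext h1 h2)⟩

/-- The gluing matrix may be changed by automorphisms of both factors. -/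
def glueCongr {g h : Matrix ι ι (Λ ⧸ (I ⊔ J))} (α : (Matrix ι ι (Λ ⧸ I))ˣ)
    (β : (Matrix ι ι (Λ ⧸ J))ˣ)
    (H : h * (α : Matrix ι ι (Λ ⧸ I)).map (projLeft I J) =
      (β : Matrix ι ι (Λ ⧸ J)).map (projRight I J) * g) : glue g ≃ₗ[Λ] glue h where
  toFun x := ⟨(α.1 *ᵥ x.1.1, β.1 *ᵥ x.1.2), by
    rw [mem_glue]
    have h1 := RingHom.map_mulVec (projLeft I J).toRingHom α.1 x.1.1
    have h2 := RingHom.map_mulVec (projRight I J).toRingHom β.1 x.1.2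
    have h1' : projLeft I J ∘ (α.1 *ᵥ x.1.1) = α.1.map (projLeft I J) *ᵥ (projLeft I J ∘ x.1.1) :=
      funext h1
    have h2' : projRight I J ∘ (β.1 *ᵥ x.1.2) = β.1.map (projRight I J) *ᵥ (projRight I J ∘ x.1.2) :=
      funext h2
    simp only
    rw [h1', h2', mulVec_mulVec, H, ← mulVec_mulVec, mem_glue.1 x.2]⟩
  map_add' x y := Subtype.ext (Prod.ext (mulVec_add _ _ _) (mulVec_add _ _ _))
  map_smul' c x := Subtype.ext (Prod.ext (mulVec_smul _ _ _) (mulVec_smul _ _ _))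
  invFun x := ⟨(α⁻¹.1 *ᵥ x.1.1, β⁻¹.1 *ᵥ x.1.2), by
    rw [mem_glue]
    have h1 := RingHom.map_mulVec (projLeft I J).toRingHom α⁻¹.1 x.1.1
    have h2 := RingHom.map_mulVec (projRight I J).toRingHom β⁻¹.1 x.1.2
    have h1' : projLeft I J ∘ (α⁻¹.1 *ᵥ x.1.1) =
      α⁻¹.1.map (projLeft I J) *ᵥ (projLeft I J ∘ x.1.1) := funext h1
    have h2' : projRight I J ∘ (β⁻¹.1 *ᵥ x.1.2) =
      β⁻¹.1.map (projRight I J) *ᵥ (projRight I J ∘ x.1.2) := funext h2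
    have hα : α.1.map (projLeft I J) * α⁻¹.1.map (projLeft I J) = 1 := by
      rw [← Matrix.map_mul, α.mul_inv, Matrix.map_one _ (map_zero _) (map_one _)]
    have hβ : β⁻¹.1.map (projRight I J) * β.1.map (projRight I J) = 1 := by
      rw [← Matrix.map_mul, β.inv_mul, Matrix.map_one _ (map_zero _) (map_one _)]
    have H' : g * α⁻¹.1.map (projLeft I J) = β⁻¹.1.map (projRight I J) * h := by
      calc g * α⁻¹.1.map (projLeft I J)
          = β⁻¹.1.map (projRight I J) * (β.1.map (projRight I J) * g) * α⁻¹.1.map (projLeft I J) := by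
            rw [← mul_assoc, hβ, one_mul]
        _ = β⁻¹.1.map (projRight I J) * h * (α.1.map (projLeft I J) * α⁻¹.1.map (projLeft I J)) := by
            rw [← H]; simp only [mul_assoc]
        _ = _ := by rw [hα, mul_one]
    simp only
    rw [h1', h2', mulVec_mulVec, H', ← mulVec_mulVec, mem_glue.1 x.2]⟩
  left_inv x := by
    refine Subtype.ext (Prod.ext ?_ ?_)
    · simp only [mulVec_mulVec, Units.inv_mul, one_mulVec]
    · simp only [mulVec_mulVec, Units.inv_mul, one_mulVec]
  right_inv x := by
    refine Subtype.ext (Prod.ext ?_ ?_)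
    · simp only [mulVec_mulVec, Units.mul_inv, one_mulVec]
    · simp only [mulVec_mulVec, Units.mul_inv, one_mulVec]

/-- Both factors lift to invertible matrices: the left one over `Λ / J`, the right one over `Λ / I`.
They are then absorbed by automorphisms of the two free modules being glued. -/
theorem nonempty_glue_equiv_of_transvections {g h L L' : Matrix ι ι (Λ ⧸ (I ⊔ J))}
    (hL : L ∈ transvectionMonoid ι (Λ ⧸ (I ⊔ J))) (hL' : L' ∈ transvectionMonoid ι (Λ ⧸ (I ⊔ J)))
    (H : g = L * h * L') : Nonempty (glue g ≃ₗ[Λ] glue h) := by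
  obtain ⟨N, rfl⟩ := exists_lift_of_mem_transvectionMonoid
    (f := (projRight I J : Λ ⧸ J →+* Λ ⧸ (I ⊔ J))) (projRight_surjective I J) hL
  obtain ⟨N', rfl⟩ := exists_lift_of_mem_transvectionMonoid
    (f := (projLeft I J : Λ ⧸ I →+* Λ ⧸ (I ⊔ J))) (projLeft_surjective I J) hL'
  refine ⟨glueCongr N' N⁻¹ ?_⟩
  have hN : N⁻¹.1.map (projRight I J) * N.1.map (projRight I J) = 1 := by
    rw [← Matrix.map_mul, N.inv_mul, Matrix.map_one _ (map_zero _) (map_one _)]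
  rw [H]
  change h * N'.1.map (projLeft I J) = N⁻¹.1.map (projRight I J) *
    (N.1.map (projRight I J) * h * N'.1.map (projLeft I J))
  rw [← mul_assoc, ← mul_assoc, hN, one_mul]

theorem apply_mem_of_mem_smul_top {X : Type*} [AddCommGroup X] [Module Λ X] (f : X →ₗ[Λ] Λ)
    {K : Ideal Λ} {x : X} (hx : x ∈ K • (⊤ : Submodule Λ X)) : f x ∈ K := by
  induction hx using Submodule.smul_induction_on' with
  | smul c hc y _ =>
    rw [map_smul]
    exact K.mul_mem_right _ hc
  | add a _ b _ ha hb =>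
    rw [map_add]
    exact K.add_mem ha hb

/-- Milnor's patching: `f₁` and `f₂` identify `X/IX` and `X/JX` with free modules, hence give two
bases of `X/(I+J)X`. The matrix `g` is the change of basis, and projectivity with `I ∩ J = 0`
recovers `X` from the two quotients. -/
theorem exists_glue_equiv {X : Type*} [AddCommGroup X] [Module Λ X] [Module.Projective Λ X]
    (hIJ : I ⊓ J = ⊥) (f₁ : X →ₗ[Λ] (ι → Λ ⧸ I)) (f₂ : X →ₗ[Λ] (ι → Λ ⧸ J))
    (hf₁ : Function.Surjective f₁) (hf₂ : Function.Surjective f₂)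
    (hk₁ : LinearMap.ker f₁ = I • ⊤) (hk₂ : LinearMap.ker f₂ = J • ⊤) :
    ∃ g : Matrix ι ι (Λ ⧸ (I ⊔ J)), IsUnit g ∧ Nonempty (X ≃ₗ[Λ] glue g) := by
  have vanish : ∀ x ∈ (I ⊔ J) • (⊤ : Submodule Λ X),
      projLeft I J ∘ f₁ x = 0 ∧ projRight I J ∘ f₂ x = 0 := by
    intro x hx
    have hz : ∀ c ∈ I ⊔ J, ∀ y : Λ ⧸ (I ⊔ J), c • y = 0 := fun c hc y => by
      rw [Algebra.smul_def]
      rw [show algebraMap Λ (Λ ⧸ (I ⊔ J)) c = 0 from Ideal.Quotient.eq_zero_iff_mem.2 hc, zero_mul]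
    induction hx using Submodule.smul_induction_on' with
    | smul c hc y _ =>
      constructor <;> ext i <;> simp [hz c hc]
    | add a _ b _ ha hb =>
      constructor
      · ext i
        have h1 := congrFun ha.1 i
        have h2 := congrFun hb.1 i
        simp_all
      · ext i
        have h1 := congrFun ha.2 i
        have h2 := congrFun hb.2 i
        simp_all
  have vanI : ∀ x, f₁ x = 0 → projRight I J ∘ f₂ x = 0 := fun x hx =>
    (vanish x (Submodule.smul_mono_left le_sup_left (hk₁ ▸ LinearMap.mem_ker.2 hx))).2
  have vanJ : ∀ x, f₂ x = 0 → projLeft I J ∘ f₁ x = 0 := fun x hx =>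
    (vanish x (Submodule.smul_mono_left le_sup_right (hk₂ ▸ LinearMap.mem_ker.2 hx))).1
  choose s hs using fun i : ι => hf₁ (Pi.single i 1)
  choose t ht using fun i : ι => hf₂ (Pi.single i 1)
  have key₁ : ∀ x, (Matrix.of fun i j => projRight I J (f₂ (s j) i)) *ᵥ (projLeft I J ∘ f₁ x) =
      projRight I J ∘ f₂ x := by
    intro x
    -- Subtracting lifts of the basis vectors with these coefficients moves `x` into `ker f₁ = IX`,
    -- where the reduction of `f₂` vanishes.
    choose c hc using fun i => Ideal.Quotient.mk_surjective (f₁ x i)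
    have h0 : f₁ (x - ∑ i, c i • s i) = 0 := by
      rw [map_sub, map_sum, sub_eq_zero]
      ext i
      simp only [map_smul, hs, Finset.sum_apply, Pi.smul_apply]
      rw [Finset.sum_eq_single i (fun j _ hj => by rw [Pi.single_eq_of_ne hj.symm, smul_zero])
        (by simp), Pi.single_eq_same, ← hc i, Algebra.smul_def, mul_one]
      rfl
    ext i
    have := congrFun (vanI _ h0) i
    simp only [Function.comp_apply, map_sub, map_sum, map_smul, Pi.sub_apply, Finset.sum_apply,
      Pi.smul_apply, Pi.zero_apply, sub_eq_zero] at this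
    rw [Function.comp_apply, this]
    refine Finset.sum_congr rfl fun j _ => ?_
    rw [Function.comp_apply, ← hc j, Algebra.smul_def, mul_comm]
    rfl
  have key₂ : ∀ x, (Matrix.of fun i j => projLeft I J (f₁ (t j) i)) *ᵥ (projRight I J ∘ f₂ x) =
      projLeft I J ∘ f₁ x := by
    intro x
    choose c hc using fun i => Ideal.Quotient.mk_surjective (f₂ x i)
    have h0 : f₂ (x - ∑ i, c i • t i) = 0 := by
      rw [map_sub, map_sum, sub_eq_zero]
      ext i
      simp only [map_smul, ht, Finset.sum_apply, Pi.smul_apply]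
      rw [Finset.sum_eq_single i (fun j _ hj => by rw [Pi.single_eq_of_ne hj.symm, smul_zero])
        (by simp), Pi.single_eq_same, ← hc i, Algebra.smul_def, mul_one]
      rfl
    ext i
    have := congrFun (vanJ _ h0) i
    simp only [Function.comp_apply, map_sub, map_sum, map_smul, Pi.sub_apply, Finset.sum_apply,
      Pi.smul_apply, Pi.zero_apply, sub_eq_zero] at this
    rw [Function.comp_apply, this]
    refine Finset.sum_congr rfl fun j _ => ?_
    rw [Function.comp_apply, ← hc j, Algebra.smul_def, mul_comm]
    rfl
  set g : Matrix ι ι (Λ ⧸ (I ⊔ J)) := Matrix.of fun i j => projRight I J (f₂ (s j) i) with hg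
  set h : Matrix ι ι (Λ ⧸ (I ⊔ J)) := Matrix.of fun i j => projLeft I J (f₁ (t j) i)
  have hgh : g * h = 1 := by
    refine Matrix.ext_of_mulVec_single fun i => ?_
    have e1 : projRight I J ∘ f₂ (t i) = Pi.single i 1 := by
      rw [ht]
      ext j
      rw [Function.comp_apply, Pi.single_apply, Pi.single_apply]
      split_ifs <;> simp
    rw [← e1, ← mulVec_mulVec, key₂, key₁, one_mulVec]
  refine ⟨g, (Matrix.isUnit_iff_isUnit_det _).2 (IsUnit.of_mul_eq_one (b := h.det) (by
    rw [← det_mul, hgh, det_one])), ⟨LinearEquiv.ofBijective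
      ((f₁.prod f₂).codRestrict (glue g) fun x => mem_glue.2 (key₁ x)) ⟨?_, ?_⟩⟩⟩
  · rw [← LinearMap.ker_eq_bot, LinearMap.ker_eq_bot']
    intro x hx
    have hx' := congrArg Subtype.val hx
    have h1 : x ∈ I • (⊤ : Submodule Λ X) := hk₁ ▸ LinearMap.mem_ker.2 (congrArg Prod.fst hx')
    have h2 : x ∈ J • (⊤ : Submodule Λ X) := hk₂ ▸ LinearMap.mem_ker.2 (congrArg Prod.snd hx')
    -- `σ` embeds `X` in a free module; there the coordinates of an element of `IX ∩ JX` lie in `I ∩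
    -- J = 0`.
    obtain ⟨σ, hσ⟩ := Module.projective_def'.1 ‹Module.Projective Λ X›
    have coord : ∀ (K : Ideal Λ), x ∈ K • (⊤ : Submodule Λ X) → ∀ y, σ x y ∈ K := by
      intro K hK y
      exact apply_mem_of_mem_smul_top ((Finsupp.lapply y).comp σ) hK
    have h0 : σ x = 0 := by
      ext y
      have : σ x y ∈ I ⊓ J := ⟨coord I h1 y, coord J h2 y⟩
      rwa [hIJ] at this
    have := LinearMap.congr_fun hσ x
    rw [LinearMap.comp_apply, h0, map_zero] at this
    exact this.symm
  · rintro ⟨⟨a, b⟩, hab⟩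
    rw [mem_glue] at hab
    obtain ⟨x, rfl⟩ := hf₁ a
    simp only [key₁] at hab
    -- The error in the second component dies in `Λ / (I + J)`, so it lifts to elements of `I`;
    -- correcting by an element of `IX` leaves `f₁ x` unchanged.
    have hmem : ∀ i, ∃ c ∈ I, Ideal.Quotient.mk J c = b i - f₂ x i := by
      intro i
      obtain ⟨c, h1, h2⟩ := exists_eq_of_proj_eq (I := I) (J := J) (a := 0) (b := b i - f₂ x i) (by
        rw [map_zero, map_sub]
        exact (sub_eq_zero.2 (congrFun hab i).symm).symm)
      exact ⟨c, Ideal.Quotient.eq_zero_iff_mem.1 h1, h2⟩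
    choose c hcI hc using hmem
    have hz : ∑ i, c i • t i ∈ I • (⊤ : Submodule Λ X) :=
      Submodule.sum_mem _ fun i _ => Submodule.smul_mem_smul (hcI i) trivial
    refine ⟨x + ∑ i, c i • t i, Subtype.ext (Prod.ext ?_ ?_)⟩
    · change f₁ _ = _
      rw [← hk₁, LinearMap.mem_ker] at hz
      rw [map_add, hz, add_zero]
    · change f₂ _ = b
      rw [map_add, map_sum]
      ext i
      simp only [map_smul, ht, Finset.sum_apply, Pi.smul_apply, Pi.add_apply]
      rw [Finset.sum_eq_single i (fun j _ hj => by rw [Pi.single_eq_of_ne hj.symm, smul_zero])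
        (by simp), Pi.single_eq_same, Algebra.smul_def, mul_one]
      change f₂ x i + Ideal.Quotient.mk J (c i) = b i
      rw [hc, add_sub_cancel]

end MilnorSquare

end

/-! ### Rank-one gluings and invariants of isomorphic gluings. -/

noncomputable section

namespace MilnorSquare

open Matrix LocallyFree

section line

variable {Λ : Type w} [CommRing Λ] {I J : Ideal Λ}

/-- Multiplying the gluing factor by units that lift to `Λ / I` and `Λ / J`. -/
def lineCongr {u v : Λ ⧸ (I ⊔ J)} (a : (Λ ⧸ I)ˣ) (b : (Λ ⧸ J)ˣ)
    (H : v * projLeft I J a = projRight I J b * u) : line u ≃ₗ[Λ] line v where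
  toFun x := ⟨(a * x.1.1, b * x.1.2), by
    rw [mem_line, map_mul, map_mul, ← mul_assoc, H, mul_assoc, mem_line.1 x.2]⟩
  map_add' x y := Subtype.ext (Prod.ext (mul_add _ _ _) (mul_add _ _ _))
  map_smul' c x := Subtype.ext (Prod.ext (mul_smul_comm _ _ _) (mul_smul_comm _ _ _))
  invFun x := ⟨(a⁻¹.1 * x.1.1, b⁻¹.1 * x.1.2), by
    have h1 : projLeft I J a * projLeft I J a⁻¹.1 = 1 := by rw [← map_mul, a.mul_inv, map_one]
    have h2 : projRight I J b * projRight I J b⁻¹.1 = 1 := by rw [← map_mul, b.mul_inv, map_one]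
    have h3 := mem_line.1 x.2
    rw [mem_line, map_mul, map_mul, ← h3]
    linear_combination (-(projLeft I J a⁻¹.1 * projRight I J b⁻¹.1 * projLeft I J x.1.1)) * H
      - (projLeft I J a⁻¹.1 * projLeft I J x.1.1 * u) * h2
      + (projRight I J b⁻¹.1 * v * projLeft I J x.1.1) * h1⟩
  left_inv x := by
    refine Subtype.ext (Prod.ext ?_ ?_) <;> simp only [Units.inv_mul_cancel_left]
  right_inv x := by
    refine Subtype.ext (Prod.ext ?_ ?_) <;> simp only [Units.mul_inv_cancel_left]

theorem exists_fst_eq_one_mem_line (u : Λ ⧸ (I ⊔ J)) :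
    ∃ b, ((1, b) : (Λ ⧸ I) × (Λ ⧸ J)) ∈ line u := by
  obtain ⟨b, hb⟩ := projRight_surjective I J u
  exact ⟨b, by rw [mem_line, map_one, mul_one, hb]⟩

theorem exists_snd_eq_one_mem_line (u : (Λ ⧸ (I ⊔ J))ˣ) :
    ∃ a, ((a, 1) : (Λ ⧸ I) × (Λ ⧸ J)) ∈ line (u : Λ ⧸ (I ⊔ J)) := by
  obtain ⟨a, ha⟩ := projLeft_surjective I J u⁻¹.1
  exact ⟨a, by rw [mem_line, map_one, ha, u.mul_inv]⟩

theorem smul_eq_zero_of_mem {K : Ideal Λ} {c : Λ} (hc : c ∈ K) (a : Λ ⧸ K) : c • a = 0 := by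
  rw [Algebra.smul_def, show algebraMap Λ (Λ ⧸ K) c = 0 from Ideal.Quotient.eq_zero_iff_mem.2 hc,
    zero_mul]

/-- The second coordinate vanishes in `Λ / (I + J)`, so it lifts to some `c ∈ I`, and the element is
`c` times a point of the line with second coordinate `1`. -/
theorem mem_smul_top_of_fst_eq_zero (u : (Λ ⧸ (I ⊔ J))ˣ) (x : line (u : Λ ⧸ (I ⊔ J)))
    (hx : x.1.1 = 0) : x ∈ I • (⊤ : Submodule Λ (line (u : Λ ⧸ (I ⊔ J)))) := by
  obtain ⟨⟨a, b⟩, h⟩ := x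
  obtain rfl : a = 0 := hx
  rw [mem_line, map_zero, mul_zero] at h
  obtain ⟨c, h1, rfl⟩ := exists_eq_of_proj_eq (I := I) (J := J) (a := 0) (b := b) (by rw [map_zero, h])
  have hc := Ideal.Quotient.eq_zero_iff_mem.1 h1
  obtain ⟨s, hs⟩ := exists_snd_eq_one_mem_line u
  convert! Submodule.smul_mem_smul hc (Submodule.mem_top (x := (⟨_, hs⟩ : line (u : Λ ⧸ (I ⊔ J))))) using 1
  refine Subtype.ext (Prod.ext ?_ ?_)
  · exact (smul_eq_zero_of_mem hc s).symm
  · exact ((Algebra.smul_def c (1 : Λ ⧸ J)).trans (mul_one _)).symm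

theorem mem_smul_top_of_snd_eq_zero (u : (Λ ⧸ (I ⊔ J))ˣ) (x : line (u : Λ ⧸ (I ⊔ J)))
    (hx : x.1.2 = 0) : x ∈ J • (⊤ : Submodule Λ (line (u : Λ ⧸ (I ⊔ J)))) := by
  obtain ⟨⟨a, b⟩, h⟩ := x
  obtain rfl : b = 0 := hx
  rw [mem_line, map_zero] at h
  have h' : projLeft I J a = 0 := by
    have := congrArg (u⁻¹.1 * ·) h
    simpa using this
  obtain ⟨c, rfl, h1⟩ := exists_eq_of_proj_eq (I := I) (J := J) (a := a) (b := 0) (by rw [map_zero, h'])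
  have hc := Ideal.Quotient.eq_zero_iff_mem.1 h1
  obtain ⟨s, hs⟩ := exists_fst_eq_one_mem_line (u : Λ ⧸ (I ⊔ J))
  convert! Submodule.smul_mem_smul hc (Submodule.mem_top (x := (⟨_, hs⟩ : line (u : Λ ⧸ (I ⊔ J))))) using 1
  refine Subtype.ext (Prod.ext ?_ ?_)
  · exact ((Algebra.smul_def c (1 : Λ ⧸ I)).trans (mul_one _)).symm
  · exact (smul_eq_zero_of_mem hc s).symm

/-- The idempotent separates the square over `B`: `I` dies on the part `eB` and `J` on `(1-e)B`. On
each part the line is generated by a point with the matching coordinate `1`, so no gluing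
obstruction survives. -/
theorem nonempty_baseChange_line_equiv {B : Type w} [CommRing B] [Algebra Λ B] {e : B}
    (he : e * e = e) (heI : ∀ c ∈ I, e * algebraMap Λ B c = 0)
    (heJ : ∀ c ∈ J, (1 - e) * algebraMap Λ B c = 0) (u : (Λ ⧸ (I ⊔ J))ˣ) :
    Nonempty ((B ⊗[Λ] line (u : Λ ⧸ (I ⊔ J))) ≃ₗ[B] B) := by
  let j₁ : (Λ ⧸ I) →ₗ[Λ] B := I.liftQ ((LinearMap.mulLeft Λ e).comp (Algebra.linearMap Λ B)) heI
  let j₂ : (Λ ⧸ J) →ₗ[Λ] B := J.liftQ ((LinearMap.mulLeft Λ (1 - e)).comp (Algebra.linearMap Λ B)) heJ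
  have hj₁ : ∀ c, j₁ (Ideal.Quotient.mk I c) = e * algebraMap Λ B c := fun c => rfl
  have hj₂ : ∀ c, j₂ (Ideal.Quotient.mk J c) = (1 - e) * algebraMap Λ B c := fun c => rfl
  let j : line (u : Λ ⧸ (I ⊔ J)) →ₗ[Λ] B := (j₁.coprod j₂).comp (Submodule.subtype _)
  have hj : ∀ x, j x = j₁ x.1.1 + j₂ x.1.2 := fun x => rfl
  obtain ⟨r, hr⟩ := exists_fst_eq_one_mem_line (u : Λ ⧸ (I ⊔ J))
  obtain ⟨s, hs⟩ := exists_snd_eq_one_mem_line u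
  have kill : ∀ (K : Ideal Λ) (f : B), (∀ c ∈ K, f * algebraMap Λ B c = 0) →
      ∀ z ∈ K • (⊤ : Submodule Λ (line (u : Λ ⧸ (I ⊔ J)))), f ⊗ₜ[Λ] z = 0 := by
    intro K f hf z hz
    induction hz using Submodule.smul_induction_on' with
    | smul c hc y _ =>
      rw [← TensorProduct.smul_tmul, Algebra.smul_def, mul_comm, hf c hc, TensorProduct.zero_tmul]
    | add a _ b _ ha hb => rw [TensorProduct.tmul_add, ha, hb, add_zero]
  -- The free generator, assembled from the local generators `(1, r)` and `(s, 1)`.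
  let w : B ⊗[Λ] line (u : Λ ⧸ (I ⊔ J)) := e ⊗ₜ ⟨_, hr⟩ + (1 - e) ⊗ₜ ⟨_, hs⟩
  have hone₁ : j₁ 1 = e := by
    rw [← map_one (Ideal.Quotient.mk I), hj₁, map_one, mul_one]
  have hone₂ : j₂ 1 = 1 - e := by
    rw [← map_one (Ideal.Quotient.mk J), hj₂, map_one, mul_one]
  have he' : e * (1 - e) = 0 := by rw [mul_sub, mul_one, he, sub_self]
  refine ⟨LinearEquiv.ofLinearMap (LinearMap.liftBaseChange B j) (LinearMap.toSpanSingleton B _ w) ?_ ?_⟩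
  · ext
    obtain ⟨r, rfl⟩ := Ideal.Quotient.mk_surjective r
    obtain ⟨s, rfl⟩ := Ideal.Quotient.mk_surjective s
    simp only [LinearMap.comp_apply, LinearMap.toSpanSingleton_apply, one_smul, w, map_add,
      LinearMap.liftBaseChange_tmul, hj, hone₁, hone₂, hj₁, hj₂, LinearMap.id_apply, smul_eq_mul]
    linear_combination he + (algebraMap Λ B r + algebraMap Λ B s) * he' + he
  · ext x
    obtain ⟨α, hα⟩ := Ideal.Quotient.mk_surjective x.1.1
    obtain ⟨β, hβ⟩ := Ideal.Quotient.mk_surjective x.1.2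
    have h1 : e ⊗ₜ[Λ] x = (e * algebraMap Λ B α) ⊗ₜ (⟨_, hr⟩ : line (u : Λ ⧸ (I ⊔ J))) := by
      rw [mul_comm, ← Algebra.smul_def, TensorProduct.smul_tmul, ← sub_eq_zero,
        ← TensorProduct.tmul_sub]
      refine kill I e heI _ (mem_smul_top_of_fst_eq_zero u _ ?_)
      change x.1.1 - α • (1 : Λ ⧸ I) = 0
      rw [← hα, Algebra.smul_def, mul_one, sub_eq_zero]
      rfl
    have h2 : (1 - e) ⊗ₜ[Λ] x =
        ((1 - e) * algebraMap Λ B β) ⊗ₜ (⟨_, hs⟩ : line (u : Λ ⧸ (I ⊔ J))) := by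
      rw [mul_comm, ← Algebra.smul_def, TensorProduct.smul_tmul, ← sub_eq_zero,
        ← TensorProduct.tmul_sub]
      refine kill J (1 - e) heJ _ (mem_smul_top_of_snd_eq_zero u _ ?_)
      change x.1.2 - β • (1 : Λ ⧸ J) = 0
      rw [← hβ, Algebra.smul_def, mul_one, sub_eq_zero]
      rfl
    have h3 : (1 : B) ⊗ₜ[Λ] x = e ⊗ₜ x + (1 - e) ⊗ₜ x := by
      rw [← TensorProduct.add_tmul, add_sub_cancel]
    have h4 : j x = e * algebraMap Λ B α + (1 - e) * algebraMap Λ B β := by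
      rw [hj, ← hα, ← hβ, hj₁, hj₂]
    simp only [TensorProduct.AlgebraTensorModule.curry_apply, LinearMap.restrictScalars_comp,
      LinearMap.comp_apply, TensorProduct.curry_apply, LinearMap.coe_restrictScalars,
      LinearMap.liftBaseChange_tmul, one_smul, LinearMap.toSpanSingleton_apply, LinearMap.id_apply]
    rw [h3, h1, h2, h4, smul_add, TensorProduct.smul_tmul', TensorProduct.smul_tmul', smul_eq_mul,
      smul_eq_mul]
    congr 2
    · linear_combination (algebraMap Λ B α - algebraMap Λ B β) * he
    · linear_combination (algebraMap Λ B α - algebraMap Λ B β) * he'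

variable {O : Type u} [CommRing O] [Algebra O Λ]

/-- Scaling one coordinate by `r` gives maps between this line and the line of `1` whose composites,
in both orders, are multiplication by `r`, a unit after localization at `P`. The line of `1` is `Λ`
itself. -/
theorem nonempty_locAt_line_equiv (hIJ : I ⊓ J = ⊥) (P : Ideal O) [P.IsPrime] {r : O} (hr : r ∉ P) :
    Nonempty ((LocAt O Λ P ⊗[Λ] line (Ideal.Quotient.mk (I ⊔ J) (algebraMap O Λ r)))
      ≃ₗ[LocAt O Λ P] (Fin 1 → LocAt O Λ P)) := by
  let L := LocAt O Λ P
  let u := Ideal.Quotient.mk (I ⊔ J) (algebraMap O Λ r)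
  let c := algebraMap O Λ r
  have hsm : ∀ K : Ideal Λ, ∀ a : Λ ⧸ K, c • a = Ideal.Quotient.mk K c * a := fun K a =>
    Algebra.smul_def c a
  let f : line (1 : Λ ⧸ (I ⊔ J)) →ₗ[Λ] line u :=
    ((LinearMap.prodMap LinearMap.id (LinearMap.lsmul Λ (Λ ⧸ J) c)).comp
      (Submodule.subtype _)).codRestrict (line u) fun x => by
        have := mem_line.1 x.2
        rw [one_mul] at this
        rw [mem_line]
        change u * projLeft I J x.1.1 = projRight I J (c • x.1.2)
        rw [this, hsm, map_mul]
        rfl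
  let h : line u →ₗ[Λ] line (1 : Λ ⧸ (I ⊔ J)) :=
    ((LinearMap.prodMap (LinearMap.lsmul Λ (Λ ⧸ I) c) LinearMap.id).comp
      (Submodule.subtype _)).codRestrict (line 1) fun x => by
        have := mem_line.1 x.2
        rw [mem_line, one_mul]
        change projLeft I J (c • x.1.1) = projRight I J x.1.2
        rw [← this, hsm, map_mul]
        rfl
  have hfh : f.comp h = c • LinearMap.id := rfl
  have hhf : h.comp f = c • LinearMap.id := rfl
  have hunit : IsUnit (algebraMap Λ L c) :=
    IsLocalization.map_units L (⟨c, r, hr, rfl⟩ : Algebra.algebraMapSubmonoid Λ P.primeCompl)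
  have bij : ∀ (M : Type w) [AddCommGroup M] [Module Λ M],
      Function.Bijective ((c • LinearMap.id : M →ₗ[Λ] M).baseChange L) := by
    intro M _ _
    rw [LinearMap.baseChange_smul, LinearMap.baseChange_id]
    have : ⇑(c • (LinearMap.id : (L ⊗[Λ] M) →ₗ[L] (L ⊗[Λ] M))) =
        fun x => (hunit.unit • x) := by
      ext x
      exact (algebraMap_smul L c x).symm
    rw [this]
    exact MulAction.bijective hunit.unit
  have b1 := bij (line u)
  have b2 := bij (line (1 : Λ ⧸ (I ⊔ J)))
  rw [← hfh, LinearMap.baseChange_comp, LinearMap.coe_comp] at b1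
  rw [← hhf, LinearMap.baseChange_comp, LinearMap.coe_comp] at b2
  have e1 : (L ⊗[Λ] line u) ≃ₗ[L] (L ⊗[Λ] line (1 : Λ ⧸ (I ⊔ J))) :=
    LinearEquiv.ofBijective (h.baseChange L) ⟨b1.1.of_comp, b2.2.of_comp⟩
  exact ⟨e1.trans (((lineOne hIJ).symm.baseChange Λ L _ _).trans
    ((TensorProduct.AlgebraTensorModule.rid Λ L L).trans (LinearEquiv.funUnique (Fin 1) L L).symm))⟩

theorem isLocallyFree_line [IsNoetherianRing Λ] (hIJ : I ⊓ J = ⊥) {u : Λ ⧸ (I ⊔ J)}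
    (hu : ∀ (P : Ideal O) [P.IsMaximal], ∃ r ∉ P, Ideal.Quotient.mk (I ⊔ J) (algebraMap O Λ r) = u) :
    IsLocallyFree O Λ (line u) := by
  refine ⟨inferInstance, 1, fun P _ => ?_⟩
  obtain ⟨r, hr, rfl⟩ := hu P
  exact nonempty_locAt_line_equiv hIJ P hr

end line

section equiv

variable {Λ : Type w} [CommRing Λ] {I J : Ideal Λ}
variable {ι κ : Type} [Fintype ι] [Fintype κ]

theorem exists_linearEquiv_of_surjective {M N P Q : Type*} [AddCommGroup M] [AddCommGroup N]
    [AddCommGroup P] [AddCommGroup Q] [Module Λ M] [Module Λ N] [Module Λ P] [Module Λ Q]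
    (p : M →ₗ[Λ] P) (q : N →ₗ[Λ] Q) (hp : Function.Surjective p) (hq : Function.Surjective q)
    (e : M ≃ₗ[Λ] N) (he : ∀ x, p x = 0 ↔ q (e x) = 0) :
    ∃ f : P ≃ₗ[Λ] Q, ∀ x, f (p x) = q (e x) := by
  have hk : (LinearMap.ker p).map (e : M →ₗ[Λ] N) = LinearMap.ker q := by
    ext y
    obtain ⟨x, rfl⟩ := e.surjective y
    simp only [Submodule.mem_map, LinearMap.mem_ker, LinearEquiv.coe_coe]
    exact ⟨fun ⟨z, hz, h⟩ => e.injective h ▸ (he z).1 hz, fun h => ⟨x, (he x).2 h, rfl⟩⟩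
  refine ⟨(p.quotKerEquivOfSurjective hp).symm.trans
    ((Submodule.Quotient.equiv _ _ e hk).trans (q.quotKerEquivOfSurjective hq)), fun x => ?_⟩
  have : (p.quotKerEquivOfSurjective hp).symm (p x) = Submodule.Quotient.mk x := by
    rw [LinearEquiv.symm_apply_eq]
    rfl
  simp only [LinearEquiv.trans_apply, this]
  rfl

theorem fst_surjective_glue (g : Matrix ι ι (Λ ⧸ (I ⊔ J))) (a : ι → Λ ⧸ I) :
    ∃ b, (a, b) ∈ glue g := by
  choose b hb using fun i => projRight_surjective I J ((g *ᵥ (projLeft I J ∘ a)) i)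
  exact ⟨b, mem_glue.2 (funext fun i => (hb i).symm)⟩

variable [DecidableEq ι] [DecidableEq κ]

theorem snd_surjective_glue {g : Matrix ι ι (Λ ⧸ (I ⊔ J))} (hg : IsUnit g) (b : ι → Λ ⧸ J) :
    ∃ a, (a, b) ∈ glue g := by
  obtain ⟨g, rfl⟩ := hg
  choose a ha using fun i => projLeft_surjective I J ((g⁻¹.1 *ᵥ (projRight I J ∘ b)) i)
  refine ⟨a, mem_glue.2 ?_⟩
  rw [show projLeft I J ∘ a = _ from funext ha, mulVec_mulVec, g.mul_inv, one_mulVec]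

/-- The kernels of the two coordinate projections are intrinsic: under `hJ` and `hI` they are the
elements killed by `J` and by `I`. Hence any isomorphism descends to both coordinates. -/
theorem exists_equiv_of_glue_equiv (hJ : ∀ a : Λ ⧸ I, (∀ c ∈ J, c • a = 0) → a = 0)
    (hI : ∀ b : Λ ⧸ J, (∀ c ∈ I, c • b = 0) → b = 0) {g : Matrix ι ι (Λ ⧸ (I ⊔ J))}
    {h : Matrix κ κ (Λ ⧸ (I ⊔ J))} (hg : IsUnit g) (hh : IsUnit h) (e : glue g ≃ₗ[Λ] glue h) :
    ∃ (e₁ : (ι → Λ ⧸ I) ≃ₗ[Λ] (κ → Λ ⧸ I)) (e₂ : (ι → Λ ⧸ J) ≃ₗ[Λ] (κ → Λ ⧸ J)),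
      ∀ a b, (a, b) ∈ glue g → (e₁ a, e₂ b) ∈ glue h := by
  have fst_iff : ∀ {μ : Type} [Fintype μ] (k : Matrix μ μ (Λ ⧸ (I ⊔ J))) (x : glue k),
      x.1.1 = 0 ↔ ∀ c ∈ J, c • x = 0 := by
    intro μ _ k x
    constructor
    · intro hx c hc
      refine Subtype.ext (Prod.ext ?_ (funext fun i => smul_eq_zero_of_mem hc _))
      change c • x.1.1 = 0
      rw [hx, smul_zero]
    · intro hx
      ext i
      exact hJ _ fun c hc => congrFun (congrArg (fun y : glue k => y.1.1) (hx c hc)) i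
  have snd_iff : ∀ {μ : Type} [Fintype μ] (k : Matrix μ μ (Λ ⧸ (I ⊔ J))) (x : glue k),
      x.1.2 = 0 ↔ ∀ c ∈ I, c • x = 0 := by
    intro μ _ k x
    constructor
    · intro hx c hc
      refine Subtype.ext (Prod.ext (funext fun i => smul_eq_zero_of_mem hc _) ?_)
      change c • x.1.2 = 0
      rw [hx, smul_zero]
    · intro hx
      ext i
      exact hI _ fun c hc => congrFun (congrArg (fun y : glue k => y.1.2) (hx c hc)) i
  have zero_iff : ∀ (K : Ideal Λ) (x : glue g), (∀ c ∈ K, c • x = 0) ↔ ∀ c ∈ K, c • e x = 0 := by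
    intro K x
    refine forall₂_congr fun c _ => ?_
    rw [← map_smul, LinearEquiv.map_eq_zero_iff]
  obtain ⟨e₁, h₁⟩ := exists_linearEquiv_of_surjective
    ((LinearMap.fst Λ _ _).comp (glue g).subtype) ((LinearMap.fst Λ _ _).comp (glue h).subtype)
    (fun a => (fst_surjective_glue g a).elim fun b hb => ⟨⟨_, hb⟩, rfl⟩)
    (fun a => (fst_surjective_glue h a).elim fun b hb => ⟨⟨_, hb⟩, rfl⟩) e
    fun x => (fst_iff g x).trans ((zero_iff J x).trans (fst_iff h (e x)).symm)
  obtain ⟨e₂, h₂⟩ := exists_linearEquiv_of_surjective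
    ((LinearMap.snd Λ _ _).comp (glue g).subtype) ((LinearMap.snd Λ _ _).comp (glue h).subtype)
    (fun a => (snd_surjective_glue hg a).elim fun b hb => ⟨⟨_, hb⟩, rfl⟩)
    (fun a => (snd_surjective_glue hh a).elim fun b hb => ⟨⟨_, hb⟩, rfl⟩) e
    fun x => (snd_iff g x).trans ((zero_iff I x).trans (snd_iff h (e x)).symm)
  refine ⟨e₁, e₂, fun a b hab => ?_⟩
  have : ((e₁ a, e₂ b) : (κ → Λ ⧸ I) × (κ → Λ ⧸ J)) = (e ⟨_, hab⟩).1 :=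
    Prod.ext (h₁ ⟨_, hab⟩) (h₂ ⟨_, hab⟩)
  rw [this]
  exact (e ⟨_, hab⟩).2

theorem exists_units_of_equiv {K : Ideal Λ} (e : (ι → Λ ⧸ K) ≃ₗ[Λ] (ι → Λ ⧸ K)) :
    ∃ α : Matrix ι ι (Λ ⧸ K), IsUnit α.det ∧ ∀ x, α *ᵥ x = e x := by
  let e' : (ι → Λ ⧸ K) ≃ₗ[Λ ⧸ K] (ι → Λ ⧸ K) :=
    e.extendScalarsOfSurjective Ideal.Quotient.mk_surjective
  refine ⟨LinearMap.toMatrix' e'.toLinearMap, ?_, fun x => ?_⟩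
  · rw [LinearMap.det_toMatrix']
    exact LinearEquiv.isUnit_det' e'
  · rw [LinearMap.toMatrix'_mulVec]
    rfl

/-- The induced automorphisms have matrices intertwining `g` and `h` over `Λ / (I + J)`; taking
determinants leaves the only invariant needed. -/
theorem exists_units_of_glue_equiv (hJ : ∀ a : Λ ⧸ I, (∀ c ∈ J, c • a = 0) → a = 0)
    (hI : ∀ b : Λ ⧸ J, (∀ c ∈ I, c • b = 0) → b = 0) {g h : Matrix ι ι (Λ ⧸ (I ⊔ J))}
    (hg : IsUnit g) (hh : IsUnit h) (e : glue g ≃ₗ[Λ] glue h) :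
    ∃ (a : (Λ ⧸ I)ˣ) (b : (Λ ⧸ J)ˣ), h.det * projLeft I J a = projRight I J b * g.det := by
  obtain ⟨e₁, e₂, he⟩ := exists_equiv_of_glue_equiv hJ hI hg hh e
  obtain ⟨α, hα, hα'⟩ := exists_units_of_equiv e₁
  obtain ⟨β, hβ, hβ'⟩ := exists_units_of_equiv e₂
  refine ⟨hα.unit, hβ.unit, ?_⟩
  have key : h * α.map (projLeft I J) = β.map (projRight I J) * g := by
    refine Matrix.ext_of_mulVec_single fun i => ?_
    -- A basis vector of the first factor completes to a point of the gluing, on which compatibility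
    -- can be read off.
    obtain ⟨b, hb⟩ := fst_surjective_glue g (Pi.single i 1)
    have h1 := mem_glue.1 hb
    have h2 := mem_glue.1 (he _ _ hb)
    have hs : projLeft I J ∘ (Pi.single i 1 : ι → Λ ⧸ I) = Pi.single i 1 := by
      ext j
      rw [Function.comp_apply, Pi.single_apply, Pi.single_apply]
      split_ifs <;> simp
    rw [← hα', ← hβ'] at h2
    have h3 : projLeft I J ∘ (α *ᵥ Pi.single i 1) = α.map (projLeft I J) *ᵥ Pi.single i 1 := by
      rw [← hs]
      exact funext fun j => RingHom.map_mulVec (projLeft I J).toRingHom α _ j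
    have h4 : projRight I J ∘ (β *ᵥ b) = β.map (projRight I J) *ᵥ (projRight I J ∘ b) :=
      funext fun j => RingHom.map_mulVec (projRight I J).toRingHom β _ j
    simp only at h1 h2
    rw [hs] at h1
    rw [h3, h4, ← h1] at h2
    rw [← mulVec_mulVec, ← mulVec_mulVec, h2]
  have := congrArg Matrix.det key
  rw [det_mul, det_mul] at this
  rw [IsUnit.unit_spec, IsUnit.unit_spec]
  have h5 : (α.map (projLeft I J)).det = projLeft I J α.det :=
    ((projLeft I J).toRingHom.map_det α).symm
  have h6 : (β.map (projRight I J)).det = projRight I J β.det :=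
    ((projRight I J).toRingHom.map_det β).symm
  rw [← h5, ← h6, this]

end equiv

end MilnorSquare

end

/-! ### The homomorphism from gluing units to the class group, its kernel and its range. -/

noncomputable section

namespace MilnorSquare

open Matrix LocallyFree

section tensor

variable {Λ : Type w} [CommRing Λ]

theorem exists_linearMap_of_tensor_equiv {X : Type w} [AddCommGroup X] [Module Λ X] {K : Ideal Λ}
    {ι : Type} (E : ((Λ ⧸ K) ⊗[Λ] X) ≃ₗ[Λ ⧸ K] (ι → Λ ⧸ K)) :
    ∃ f : X →ₗ[Λ] (ι → Λ ⧸ K), Function.Surjective f ∧ LinearMap.ker f = K • ⊤ := by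
  let q : X →ₗ[Λ] (Λ ⧸ K) ⊗[Λ] X := TensorProduct.mk Λ (Λ ⧸ K) X 1
  have hq : ∀ x, TensorProduct.quotTensorEquivQuotSMul X K (q x) = Submodule.Quotient.mk x := by
    intro x
    exact (TensorProduct.quotTensorEquivQuotSMul_mk_tmul K 1 x).trans (by rw [one_smul])
  refine ⟨(E.restrictScalars Λ).toLinearMap.comp q, ?_, ?_⟩
  · refine E.surjective.comp fun y => ?_
    obtain ⟨x, hx⟩ := Submodule.Quotient.mk_surjective _ (TensorProduct.quotTensorEquivQuotSMul X K y)
    exact ⟨x, (TensorProduct.quotTensorEquivQuotSMul X K).injective ((hq x).trans hx)⟩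
  · ext x
    rw [LinearMap.mem_ker, ← Submodule.Quotient.mk_eq_zero (K • (⊤ : Submodule Λ X)), ← hq,
      LinearEquiv.map_eq_zero_iff]
    exact E.map_eq_zero_iff

theorem nonempty_tensor_equiv_of_algHom {B : Type w} [CommRing B] [Algebra Λ B] {C : Type w}
    [CommRing C] [Algebra Λ C] (f : B →ₐ[Λ] C) {X : Type w} [AddCommGroup X] [Module Λ X] {n : ℕ}
    (E : (B ⊗[Λ] X) ≃ₗ[B] (Fin n → B)) : Nonempty ((C ⊗[Λ] X) ≃ₗ[C] (Fin n → C)) := by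
  let _ : Algebra B C := f.toRingHom.toAlgebra
  have : IsScalarTower Λ B C := IsScalarTower.of_algebraMap_eq fun x => (f.commutes x).symm
  exact ⟨(TensorProduct.AlgebraTensorModule.cancelBaseChange Λ B C C X).symm.trans
    ((E.baseChange B C _ _).trans (TensorProduct.piScalarRight B C C (Fin n)))⟩

end tensor

variable {O : Type u} [CommRing O] {Λ : Type w} [CommRing Λ] [Algebra O Λ] {I J : Ideal Λ}

/-- A diagonal gluing is a product of lines, and transvections do not change the glued module. -/
theorem sum_cls_line_eq {n : ℕ} {d d' : Fin n → Λ ⧸ (I ⊔ J)}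
    (hd : ∀ i, IsLocallyFree O Λ (line (d i))) (hd' : ∀ i, IsLocallyFree O Λ (line (d' i)))
    {L : Matrix (Fin n) (Fin n) (Λ ⧸ (I ⊔ J))} (hL : L ∈ transvectionMonoid (Fin n) (Λ ⧸ (I ⊔ J)))
    (H : diagonal d = L * diagonal d') :
    ∑ i, cls O (line (d i)) (hd i) = ∑ i, cls O (line (d' i)) (hd' i) := by
  rw [← cls_pi_fin, ← cls_pi_fin]
  obtain ⟨e⟩ := nonempty_glue_equiv_of_transvections (h := diagonal d') hL (one_mem _)
    (H.trans (mul_one _).symm)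
  exact cls_congr _ _ ((glueDiagonal d).symm.trans (e.trans (glueDiagonal d')))

/-- The classes of the modules of rank one glued along units of `Λ / (I + J)`. -/
def lineHom (hIJ : I ⊓ J = ⊥) (hu : ∀ u : (Λ ⧸ (I ⊔ J))ˣ, IsLocallyFree O Λ (line u.1)) :
    Additive (Λ ⧸ (I ⊔ J))ˣ →+ Cl O Λ :=
  AddMonoidHom.mk' (fun u => cls O (line u.toMul.1) (hu u.toMul)) fun u v => by
    -- From `diag(u, v) = diag(u, u⁻¹) · diag(1, uv)` one gets `[u] + [v] = [1] + [uv]`.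
    have key := sum_cls_line_eq (O := O) (d := ![u.toMul.1, v.toMul.1])
      (d' := ![1, (u.toMul * v.toMul).1])
      (Fin.forall_fin_two.2 ⟨hu u.toMul, hu v.toMul⟩)
      (Fin.forall_fin_two.2 ⟨hu 1, hu (u.toMul * v.toMul)⟩)
      (diagonal_mem_transvectionMonoid u.toMul.mul_inv) (by
        rw [diagonal_mul_diagonal]
        congr 1
        ext i
        fin_cases i <;> simp)
    rw [Fin.sum_univ_two, Fin.sum_univ_two] at key
    have h1 : cls O (line (1 : Λ ⧸ (I ⊔ J))) (hu 1) = 0 :=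
      (cls_congr _ _ (lineOne hIJ)).symm.trans cls_self
    refine Eq.trans ?_ key.symm
    refine Eq.trans ?_ (congrArg (· + _) h1.symm)
    exact (zero_add _).symm

theorem lineHom_apply (hIJ : I ⊓ J = ⊥)
    (hu : ∀ u : (Λ ⧸ (I ⊔ J))ˣ, IsLocallyFree O Λ (line u.1)) (u : (Λ ⧸ (I ⊔ J))ˣ) :
    lineHom hIJ hu (Additive.ofMul u) = cls O (line u.1) (hu u) := rfl

/-- A trivial class makes the line stably free, that is, `diag(u, 1, …, 1)` and an identity matrix
have isomorphic gluings; their determinants `u` and `1` then differ by units lifting to the two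
corners. Conversely such units give an isomorphism of the line with `Λ`. -/
theorem lineHom_eq_zero_iff [IsNoetherianRing O] [Module.Finite O Λ] [Nontrivial (Λ ⧸ I)]
    (hIJ : I ⊓ J = ⊥) (hu : ∀ u : (Λ ⧸ (I ⊔ J))ˣ, IsLocallyFree O Λ (line u.1))
    (hJ : ∀ a : Λ ⧸ I, (∀ c ∈ J, c • a = 0) → a = 0)
    (hI : ∀ b : Λ ⧸ J, (∀ c ∈ I, c • b = 0) → b = 0) (u : (Λ ⧸ (I ⊔ J))ˣ) :
    lineHom hIJ hu (Additive.ofMul u) = 0 ↔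
      ∃ (a : (Λ ⧸ I)ˣ) (b : (Λ ⧸ J)ˣ), projLeft I J a = projRight I J b * u := by
  rw [lineHom_apply]
  constructor
  · intro h
    obtain ⟨a, b, ⟨e⟩⟩ := exists_equiv_of_cls_eq_zero h
    let d : Fin (a + 1) → Λ ⧸ (I ⊔ J) := Fin.cons u.1 1
    let e1 : glue (diagonal d) ≃ₗ[Λ] (line u.1 × (Fin a → Λ)) :=
      (glueDiagonal d).trans ((Fin.consLinearEquiv Λ fun i => line (d i)).symm.trans
        (LinearEquiv.prodCongr (LinearEquiv.refl Λ _)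
          (LinearEquiv.piCongrRight fun _ => (lineOne hIJ).symm)))
    let e2 : glue (diagonal fun _ : Fin b => (1 : Λ ⧸ (I ⊔ J))) ≃ₗ[Λ] (Fin b → Λ) :=
      (glueDiagonal fun _ => 1).trans (LinearEquiv.piCongrRight fun _ => (lineOne hIJ).symm)
    have hdet : (diagonal d).det = u := by
      rw [det_diagonal, Fin.prod_univ_succ]
      simp [d]
    have hd : IsUnit (diagonal d) := (isUnit_iff_isUnit_det _).2 (hdet ▸ u.isUnit)
    have h1 : ∀ k : ℕ, IsUnit (diagonal fun _ : Fin k => (1 : Λ ⧸ (I ⊔ J))) := fun k => by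
      rw [Matrix.diagonal_one]
      exact isUnit_one
    let e3 := e1.trans (e.trans e2.symm)
    -- Invariance of rank over the nontrivial ring `Λ / I`; determinants can be compared only after
    -- the sizes agree.
    have hab : a + 1 = b := by
      obtain ⟨f, -, -⟩ := exists_equiv_of_glue_equiv hJ hI hd (h1 b) e3
      exact (Fintype.card_fin _).symm.trans ((card_eq_of_linearEquiv (Λ ⧸ I)
        (f.extendScalarsOfSurjective Ideal.Quotient.mk_surjective)).trans (Fintype.card_fin _))
    subst hab
    obtain ⟨x, y, hxy⟩ := exists_units_of_glue_equiv hJ hI hd (h1 (a + 1)) e3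
    rw [hdet, Matrix.diagonal_one, det_one, one_mul] at hxy
    exact ⟨x, y, hxy⟩
  · rintro ⟨a, b, h⟩
    have e : line u.1 ≃ₗ[Λ] Λ := (lineCongr a b (by rw [one_mul, h])).trans (lineOne hIJ).symm
    exact (cls_congr _ _ e).trans cls_self

/-- A class that dies over `B` is represented by a module that is stably free over `B`, hence over
both corners through `f₁` and `f₂`; so, up to a free summand, it is a gluing. Diagonalizing the
gluing matrix writes its class as a sum of classes of lines. The idempotent gives the other
inclusion. -/
theorem range_lineHom [IsNoetherianRing O] [Module.Finite O Λ]
    (hIJ : I ⊓ J = ⊥) (hu : ∀ u : (Λ ⧸ (I ⊔ J))ˣ, IsLocallyFree O Λ (line u.1))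
    (hdiag : IsDiagonalizableByTransvections (Λ ⧸ (I ⊔ J)))
    {B : Type w} [CommRing B] [Algebra O B] [Algebra Λ B] [IsScalarTower O Λ B] [Module.Finite O B]
    (f₁ : B →ₐ[Λ] Λ ⧸ I) (f₂ : B →ₐ[Λ] Λ ⧸ J) {e : B}
    (he : e * e = e) (heI : ∀ c ∈ I, e * algebraMap Λ B c = 0)
    (heJ : ∀ c ∈ J, (1 - e) * algebraMap Λ B c = 0) :
    (lineHom hIJ hu).range = (Cl.baseChange O Λ B).ker := by
  apply le_antisymm
  · rintro _ ⟨u, rfl⟩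
    rw [AddMonoidHom.mem_ker, ← ofMul_toMul u, lineHom_apply, baseChange_cls]
    obtain ⟨E⟩ := nonempty_baseChange_line_equiv he heI heJ u.toMul
    exact (cls_congr _ _ E).trans cls_self
  · intro z hz
    obtain ⟨X, _, _, hX, rfl⟩ := exists_cls_eq z
    rw [AddMonoidHom.mem_ker, baseChange_cls] at hz
    obtain ⟨a, b, ⟨E⟩⟩ := exists_equiv_of_cls_eq_zero hz
    let E' : (B ⊗[Λ] (X × (Fin a → Λ))) ≃ₗ[B] (Fin b → B) :=
      (TensorProduct.prodRight Λ B B X (Fin a → Λ)).trans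
        ((LinearEquiv.prodCongr (LinearEquiv.refl B _)
          (TensorProduct.piScalarRight Λ B B (Fin a))).trans E)
    obtain ⟨E₁⟩ := nonempty_tensor_equiv_of_algHom f₁ E'
    obtain ⟨E₂⟩ := nonempty_tensor_equiv_of_algHom f₂ E'
    obtain ⟨g₁, hg₁, hk₁⟩ := exists_linearMap_of_tensor_equiv E₁
    obtain ⟨g₂, hg₂, hk₂⟩ := exists_linearMap_of_tensor_equiv E₂
    have hX' := hX.prod (isLocallyFree_pi O Λ a)
    have := hX'.projective
    obtain ⟨g, hg, ⟨F⟩⟩ := exists_glue_equiv hIJ g₁ g₂ hg₁ hg₂ hk₁ hk₂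
    obtain ⟨L, hL, L', hL', d, rfl⟩ := hdiag b g
    obtain ⟨F'⟩ := nonempty_glue_equiv_of_transvections hL hL' rfl
    have hd : ∀ i, IsUnit (d i) := by
      rw [isUnit_iff_isUnit_det, det_mul, det_mul, det_diagonal] at hg
      have h1 := isUnit_of_mul_isUnit_right (isUnit_of_mul_isUnit_left hg)
      exact fun i => isUnit_of_dvd_unit (Finset.dvd_prod_of_mem d (Finset.mem_univ i)) h1
    have hd' : ∀ i, IsLocallyFree O Λ (line (d i)) := fun i => hu (hd i).unit
    have h2 : cls O X hX = ∑ i, cls O (line (d i)) (hd' i) := by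
      rw [← cls_pi_fin, ← add_zero (cls O X hX), ← cls_pi a, ← cls_prod]
      exact cls_congr _ _ (F.trans (F'.trans (glueDiagonal d)))
    rw [h2]
    exact AddSubgroup.sum_mem _ fun i _ => ⟨Additive.ofMul (hd i).unit, rfl⟩

end MilnorSquare

end

/-! ### The group ring of a cyclic group: augmentation, norm element and conjugates. -/

noncomputable section

set_option linter.unusedSectionVars false

namespace CyclicGroupRing

open MonoidAlgebra

section basic

variable (k : Type*) [CommRing k] (G : Type*) [CommGroup G]

/-- The augmentation of a group ring. -/
def aug : MonoidAlgebra k G →ₐ[k] k := MonoidAlgebra.lift k k G 1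

variable {k G} in
@[simp]
theorem aug_single (g : G) (r : k) : aug k G (single g r) = r := by
  simp [aug]

variable [Fintype G]

/-- The sum of all group elements. -/
def normElt : MonoidAlgebra k G := ∑ g : G, single g 1

theorem aug_normElt : aug k G (normElt k G) = Nat.card G := by
  simp [normElt]

variable {k G}

theorem coeff_normElt (g : G) : (normElt k G).coeff g = 1 := by
  simp [normElt, coeff_sum, Finsupp.finsetSum_apply]

theorem single_mul_normElt (g : G) (r : k) : single g r * normElt k G = r • normElt k G := by
  ext h
  rw [coeff_single_mul_apply, coeff_normElt]
  simp [coeff_normElt]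

theorem mul_normElt (x : MonoidAlgebra k G) : x * normElt k G = aug k G x • normElt k G := by
  induction x using MonoidAlgebra.induction_on with
  | of g => rw [of_apply, single_mul_normElt, aug_single]
  | add a b ha hb => rw [add_mul, ha, hb, map_add, add_smul]
  | smul r a ha => rw [smul_mul_assoc, ha, map_smul, smul_assoc]

theorem mem_span_normElt {x : MonoidAlgebra k G} :
    x ∈ Ideal.span {normElt k G} ↔ ∃ c : k, x = c • normElt k G := by
  rw [Ideal.mem_span_singleton']
  constructor
  · rintro ⟨a, rfl⟩
    exact ⟨_, mul_normElt a⟩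
  · rintro ⟨c, rfl⟩
    exact ⟨algebraMap k _ c, by rw [Algebra.smul_def]⟩

theorem eq_smul_normElt_of_coeff {x : MonoidAlgebra k G} (h : ∀ g, x.coeff g = x.coeff 1) :
    x = x.coeff 1 • normElt k G := by
  ext g
  rw [h g]
  simp [coeff_normElt]

/-- Being killed by `g - 1` means that the coefficients are invariant under translation by the
generator `g`, hence all equal. -/
theorem mem_span_normElt_of_mul_eq_zero {g : G} (hg : ∀ x, x ∈ Subgroup.zpowers g)
    {x : MonoidAlgebra k G} (h : (single g 1 - 1) * x = 0) : x ∈ Ideal.span {normElt k G} := by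
  rw [sub_mul, one_mul, sub_eq_zero] at h
  have h1 : ∀ y, x.coeff (g⁻¹ * y) = x.coeff y := fun y => by
    conv_rhs => rw [← h, coeff_single_mul_apply, one_mul]
  have h2 : ∀ n : ℕ, x.coeff (g⁻¹ ^ n) = x.coeff 1 := by
    intro n
    induction n with
    | zero => simp
    | succ n ih => rw [pow_succ', h1, ih]
  refine mem_span_normElt.2 ⟨_, eq_smul_normElt_of_coeff fun y => ?_⟩
  have hy : y ∈ Subgroup.zpowers g⁻¹ := by
    rw [Subgroup.zpowers_inv]
    exact hg y
  obtain ⟨n, rfl⟩ := mem_powers_iff_mem_zpowers.2 hy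
  exact h2 n

theorem single_sub_one_mem {g : G} (hg : ∀ x, x ∈ Subgroup.zpowers g) (h : G) :
    single h (1 : k) - 1 ∈ Ideal.span {(single g 1 - 1 : MonoidAlgebra k G)} := by
  obtain ⟨n, rfl⟩ := mem_powers_iff_mem_zpowers.2 (hg h)
  rw [Ideal.mem_span_singleton]
  have : single (g ^ n) (1 : k) = single g 1 ^ n := by rw [single_pow, one_pow]
  simp only [this]
  exact sub_one_dvd_pow_sub_one _ n

theorem sub_aug_mem {g : G} (hg : ∀ x, x ∈ Subgroup.zpowers g) (x : MonoidAlgebra k G) :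
    x - algebraMap k _ (aug k G x) ∈ Ideal.span {(single g 1 - 1 : MonoidAlgebra k G)} := by
  induction x using MonoidAlgebra.induction_on with
  | of h =>
    rw [of_apply, aug_single, map_one]
    exact single_sub_one_mem hg h
  | add a b ha hb =>
    rw [map_add, map_add, add_sub_add_comm]
    exact Ideal.add_mem _ ha hb
  | smul r a ha =>
    rw [map_smul, smul_eq_mul, map_mul, Algebra.smul_def, ← mul_sub]
    exact Ideal.mul_mem_left _ _ ha

theorem ker_aug {g : G} (hg : ∀ x, x ∈ Subgroup.zpowers g) :
    RingHom.ker (aug k G) = Ideal.span {(single g 1 - 1 : MonoidAlgebra k G)} := by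
  apply le_antisymm
  · intro x hx
    have := sub_aug_mem hg x
    rwa [show aug k G x = 0 from hx, map_zero, sub_zero] at this
  · rw [Ideal.span_singleton_le_iff_mem, RingHom.mem_ker, map_sub, aug_single, map_one, sub_self]

end basic

section conj

variable (k : Type*) [CommRing k] {G : Type*} [CommGroup G]

/-- The endomorphism of the group ring induced by the `n`-th power map of the group. -/
def powHom (G : Type*) [CommGroup G] (n : ℕ) : MonoidAlgebra k G →ₐ[k] MonoidAlgebra k G :=
  mapDomainAlgHom k k (powMonoidHom n)

variable {k}

@[simp]
theorem powHom_single (n : ℕ) (g : G) (r : k) : powHom k G n (single g r) = single (g ^ n) r := by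
  simp [powHom, powMonoidHom]

theorem aug_powHom (n : ℕ) (x : MonoidAlgebra k G) : aug k G (powHom k G n x) = aug k G x := by
  induction x using MonoidAlgebra.induction_on with
  | of g => simp
  | add a b ha hb => simp [ha, hb]
  | smul r a ha => simp [ha]

variable [Fintype G] {p : ℕ} [hp : Fact p.Prime]

theorem sum_range_single_pow (hG : Nat.card G = p) {g : G} (hg : g ≠ 1) :
    ∑ a ∈ Finset.range p, single (g ^ a) (1 : k) = normElt k G := by
  classical
  have ho : orderOf g = p := orderOf_eq_card_of_zpowers_eq_top (by
    have : Fact (Nat.card G).Prime := ⟨hG ▸ hp.out⟩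
    exact zpowers_eq_top_of_prime_card rfl hg) |>.trans hG
  have hz : ∀ x, x ∈ Subgroup.zpowers g := fun x => mem_zpowers_of_prime_card hG hg
  rw [normElt, ← IsCyclic.image_range_orderOf hz, ho, Finset.sum_image]
  rw [← ho]
  exact pow_injOn_Iio_orderOf.mono (by simp)

/-- By linearity it suffices to treat a group element: the powers of `g ≠ 1` run once through `G`,
while `g = 1` contributes `p`. Modulo the norm element this is a trace that isolates `p` times the
coefficient at `1`; the exponent `0` is included. -/
theorem sum_powHom (hG : Nat.card G = p) (x : MonoidAlgebra k G) :
    ∑ a ∈ Finset.range p, powHom k G a x =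
      algebraMap k _ (p * x.coeff 1) + (aug k G x - x.coeff 1) • normElt k G := by
  classical
  induction x using MonoidAlgebra.induction_on with
  | of g =>
    simp only [of_apply, powHom_single, aug_single]
    by_cases hg : g = 1
    · subst hg
      simp only [one_pow, Finset.sum_const, Finset.card_range, coeff_single, Finsupp.single_eq_same, sub_self,
        zero_smul, add_zero, mul_one]
      rw [map_natCast, nsmul_eq_mul, ← one_def, mul_one]
    · rw [sum_range_single_pow hG hg]
      simp [hg]
  | add a b ha hb =>
    simp only [map_add, Finset.sum_add_distrib, ha, hb, coeff_add, Finsupp.add_apply]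
    rw [mul_add, map_add]
    module
  | smul r a ha =>
    simp only [map_smul, ← Finset.smul_sum, ha, coeff_smul, Finsupp.smul_apply, smul_eq_mul]
    rw [mul_left_comm, map_mul _ r, smul_add, Algebra.smul_def, smul_smul, mul_sub]


theorem powHom_powHom (m n : ℕ) (x : MonoidAlgebra k G) :
    powHom k G m (powHom k G n x) = powHom k G (n * m) x := by
  induction x using MonoidAlgebra.induction_on with
  | of g => simp [pow_mul]
  | add a b ha hb => simp [ha, hb]
  | smul r a ha => simp [ha]

theorem powHom_mod (hG : Nat.card G = p) (n : ℕ) : powHom k G (n % p) = powHom k G n := by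
  refine AlgHom.ext fun x => ?_
  induction x using MonoidAlgebra.induction_on with
  | of g => rw [of_apply, powHom_single, powHom_single, ← hG, pow_mod_natCard]
  | add a b ha hb => simp [ha, hb]
  | smul r a ha => simp [ha]

theorem coeff_powHom_pow (hG : Nat.card G = p) {n : ℕ} (hn : p.Coprime n) (x : MonoidAlgebra k G)
    (g : G) : (powHom k G n x).coeff (g ^ n) = x.coeff g := by
  classical
  have hinj : Function.Injective (fun g : G => g ^ n) := (powCoprime (hG ▸ hn)).injective
  induction x using MonoidAlgebra.induction_on with
  | of h => simp [Finsupp.single_apply, hinj.eq_iff]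
  | add a b ha hb => simp [ha, hb]
  | smul r a ha => simp [ha]

theorem powHom_normElt (hG : Nat.card G = p) {n : ℕ} (hn : p.Coprime n) :
    powHom k G n (normElt k G) = normElt k G := by
  rw [normElt, map_sum]
  exact Fintype.sum_equiv (powCoprime (hG ▸ hn)) _ _ fun g => powHom_single n g 1

/-- The product of the conjugates of an element of the group ring of a group of prime order. -/
def conjNorm (k : Type*) [CommRing k] (G : Type*) [CommGroup G] (p : ℕ) [Fact p.Prime] :
    MonoidAlgebra k G →* MonoidAlgebra k G :=
  ∏ c : (ZMod p)ˣ, (powHom k G c.1.val : MonoidAlgebra k G →* MonoidAlgebra k G)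

theorem conjNorm_apply (x : MonoidAlgebra k G) :
    conjNorm k G p x = ∏ c : (ZMod p)ˣ, powHom k G c.1.val x := by
  simp [conjNorm]

theorem coprime_val_unit (c : (ZMod p)ˣ) : p.Coprime c.1.val :=
  (ZMod.val_coe_unit_coprime c).symm

theorem aug_conjNorm (x : MonoidAlgebra k G) : aug k G (conjNorm k G p x) = aug k G x ^ (p - 1) := by
  rw [conjNorm_apply, map_prod]
  simp [aug_powHom, ZMod.card_units_eq_totient, Nat.totient_prime hp.out]

theorem powHom_conjNorm (hG : Nat.card G = p) (d : (ZMod p)ˣ) (x : MonoidAlgebra k G) :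
    powHom k G d.1.val (conjNorm k G p x) = conjNorm k G p x := by
  rw [conjNorm_apply, map_prod]
  refine Fintype.prod_equiv (Equiv.mulRight d) _ _ fun c => ?_
  rw [powHom_powHom, ← powHom_mod hG, Equiv.coe_mulRight, Units.val_mul, ZMod.val_mul]

/-- The product of conjugates is fixed by all power maps, which permute the non-identity elements
transitively, so its coefficients away from `1` coincide. -/
theorem exists_conjNorm_eq (hG : Nat.card G = p) (x : MonoidAlgebra k G) :
    ∃ r c : k, conjNorm k G p x = algebraMap k _ r + c • normElt k G := by
  classical
  have : Nontrivial G := Finite.one_lt_card_iff_nontrivial.1 (hG ▸ hp.out.one_lt)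
  obtain ⟨g, hg⟩ := exists_ne (1 : G)
  set y := conjNorm k G p x with hy
  refine ⟨y.coeff 1 - y.coeff g, y.coeff g, ?_⟩
  ext h
  by_cases hh : h = 1
  · subst hh
    simp [coeff_normElt]
  · obtain ⟨n, rfl⟩ := mem_powers_iff_mem_zpowers.2 (mem_zpowers_of_prime_card hG hg (g' := h))
    have hn : p.Coprime n := by
      rw [hp.out.coprime_iff_not_dvd]
      rintro ⟨m, rfl⟩
      exact hh (by simp only [pow_mul, ← hG, pow_card_eq_one', one_pow])
    have h1 : y.coeff (g ^ n) = y.coeff g := by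
      have := coeff_powHom_pow (k := k) hG hn y g
      rw [← powHom_mod hG] at this
      have h2 := powHom_conjNorm (k := k) hG (ZMod.unitOfCoprime n hn.symm) x
      rw [ZMod.coe_unitOfCoprime, ZMod.val_natCast] at h2
      rw [hy] at this ⊢
      rwa [h2] at this
    change y.coeff (g ^ n) = _
    rw [h1]
    have hh' : ¬ (1 : G) = g ^ n := fun h => hh h.symm
    simp [coeff_normElt, hh']

/-- Here `x` represents a unit of `k[G]/(N)`. Its product of conjugates is `r + cN`, and `r` is a
unit because the norms of `x` and `y` multiply to `1` modulo `N` and no nonzero constant lies in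
`(N)`. The augmentation of `r + cN` is `r + cp`. -/
theorem exists_unit_of_mul_sub_one_mem (hG : Nat.card G = p) {x y : MonoidAlgebra k G}
    (hxy : x * y - 1 ∈ Ideal.span {normElt k G}) :
    ∃ (r : kˣ) (c : k), aug k G x ^ (p - 1) = r + c * p := by
  classical
  have : Nontrivial G := Finite.one_lt_card_iff_nontrivial.1 (hG ▸ hp.out.one_lt)
  obtain ⟨g, hg⟩ := exists_ne (1 : G)
  have hmap : ∀ n : ℕ, p.Coprime n → ∀ z ∈ Ideal.span {normElt k G},
      powHom k G n z ∈ Ideal.span {normElt k G} := by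
    intro n hn z hz
    obtain ⟨c, rfl⟩ := mem_span_normElt.1 hz
    rw [map_smul, powHom_normElt hG hn]
    exact mem_span_normElt.2 ⟨c, rfl⟩
  have h1 : conjNorm k G p (x * y) - 1 ∈ Ideal.span {normElt k G} := by
    rw [← Ideal.Quotient.eq_zero_iff_mem, map_sub, map_one, conjNorm_apply, map_prod, sub_eq_zero]
    refine Finset.prod_eq_one fun c _ => ?_
    have := hmap _ (coprime_val_unit c) _ hxy
    rwa [map_sub, map_one, ← Ideal.Quotient.eq_zero_iff_mem, map_sub, map_one, sub_eq_zero] at this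
  obtain ⟨r, c, hr⟩ := exists_conjNorm_eq (k := k) hG x
  obtain ⟨s, d, hs⟩ := exists_conjNorm_eq (k := k) hG y
  have h2 : r * s = 1 := by
    have hN : normElt k G ∈ Ideal.span {normElt k G} := Ideal.mem_span_singleton_self _
    have h3 : algebraMap k (MonoidAlgebra k G) (r * s - 1) ∈ Ideal.span {normElt k G} := by
      rw [map_mul, hr, hs] at h1
      have h4 : algebraMap k (MonoidAlgebra k G) (r * s - 1) =
          (algebraMap k _ r + c • normElt k G) * (algebraMap k _ s + d • normElt k G) - 1 -
          (d • algebraMap k _ r + c • algebraMap k _ s + (c * d) • normElt k G) * normElt k G := by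
        simp only [Algebra.smul_def, map_sub, map_mul, map_one]
        ring
      rw [h4]
      exact Ideal.sub_mem _ h1 (Ideal.mul_mem_left _ _ hN)
    obtain ⟨e, he⟩ := mem_span_normElt.1 h3
    have h5 := congrArg (fun z => z.coeff g) he
    have h6 := congrArg (fun z => z.coeff 1) he
    simp [coeff_normElt, Ne.symm hg] at h5 h6
    rw [← h5] at h6
    exact sub_eq_zero.1 h6
  refine ⟨⟨r, s, h2, by rw [mul_comm, h2]⟩, c, ?_⟩
  rw [← aug_conjNorm, hr, map_add, map_smul, aug_normElt, hG, AlgHom.commutes]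
  rfl

/-- The cyclotomic unit `1 + g + ⋯ + g ^ (a - 1)`. -/
theorem exists_mul_sub_one_mem (hG : Nat.card G = p) {g : G} (hg : ∀ x, x ∈ Subgroup.zpowers g)
    {a : ℕ} (ha : a.Coprime p) :
    ∃ x y : MonoidAlgebra k G, x * y - 1 ∈ Ideal.span {normElt k G} ∧ aug k G x = a := by
  obtain ⟨b, -, hb⟩ := Nat.exists_mul_mod_eq_one_of_coprime ha hp.out.one_lt
  -- Formally `x = (g^a - 1)/(g - 1)` and `y = (g^{ab} - 1)/(g^a - 1)` with `ab ≡ 1` mod `p`, so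
  -- `g^{ab} = g` and `(g - 1)(xy - 1) = 0`.
  refine ⟨∑ i ∈ Finset.range a, single g 1 ^ i, ∑ i ∈ Finset.range b, (single g 1 ^ a) ^ i,
    mem_span_normElt_of_mul_eq_zero hg ?_, by simp⟩
  have h1 : (∑ i ∈ Finset.range a, (single g 1 : MonoidAlgebra k G) ^ i) * (single g 1 - 1) =
      single g 1 ^ a - 1 := geom_sum_mul _ _
  have h2 : (∑ i ∈ Finset.range b, ((single g 1 : MonoidAlgebra k G) ^ a) ^ i) *
      (single g 1 ^ a - 1) = (single g 1 ^ a) ^ b - 1 := geom_sum_mul _ _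
  have h3 : ((single g 1 : MonoidAlgebra k G) ^ a) ^ b = single g 1 := by
    rw [single_pow, single_pow, one_pow, one_pow, ← pow_mul, ← pow_mod_natCard, hG, hb, pow_one]
  rw [h3] at h2
  rw [← h1] at h2
  linear_combination h2

end conj
end CyclicGroupRing

end

/-! ### Integral elements of the group algebra modulo the norm element. -/

noncomputable section

set_option linter.unusedSectionVars false

namespace CyclicGroupRing

open MonoidAlgebra Polynomial

section integral

variable (R : Type*) [CommRing R] (F : Type*) [Field F] [Algebra R F] (G : Type*) [CommGroup G]

/-- Extension of the coefficients of a group ring. -/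
abbrev incl : MonoidAlgebra R G →ₐ[R] MonoidAlgebra F G := mapAlgHom G (Algebra.ofId R F)

variable {R F G}

@[simp]
theorem incl_single (g : G) (r : R) : incl R F G (single g r) = single g (algebraMap R F r) := by
  ext h
  rw [coeff_mapAlgHom]
  by_cases hg : g = h
  · subst hg
    simp [Algebra.ofId_apply]
  · simp [hg]

theorem aug_incl (x : MonoidAlgebra R G) : aug F G (incl R F G x) = algebraMap R F (aug R G x) := by
  induction x using MonoidAlgebra.induction_on with
  | of g => rw [of_apply, incl_single, aug_single, aug_single]
  | add a b ha hb => simp only [map_add, ha, hb]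
  | smul r a ha =>
    rw [map_smul (incl R F G), ← algebraMap_smul F r (incl R F G a), map_smul (aug F G), ha,
      map_smul (aug R G), smul_eq_mul, smul_eq_mul, map_mul]

theorem coeff_incl (x : MonoidAlgebra R G) (g : G) :
    (incl R F G x).coeff g = algebraMap R F (x.coeff g) := by
  rw [coeff_mapAlgHom]
  rfl

theorem isIntegral_aug {b : MonoidAlgebra F G} (hb : IsIntegral R b) : IsIntegral R (aug F G b) :=
  hb.map ((aug F G).restrictScalars R)

variable [Fintype G]

theorem incl_normElt : incl R F G (normElt R G) = normElt F G := by
  ext g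
  rw [coeff_incl, coeff_normElt, coeff_normElt, map_one]

theorem mem_span_normElt_of_incl_mem [FaithfulSMul R F] {x : MonoidAlgebra R G}
    (hx : incl R F G x ∈ Ideal.span {normElt F G}) : x ∈ Ideal.span {normElt R G} := by
  obtain ⟨c, hc⟩ := mem_span_normElt.1 hx
  have h : ∀ g, algebraMap R F (x.coeff g) = c := fun g => by
    rw [← coeff_incl, hc]
    simp [coeff_normElt]
  exact mem_span_normElt.2 ⟨_, eq_smul_normElt_of_coeff fun g =>
    FaithfulSMul.algebraMap_injective R F ((h g).trans (h 1).symm)⟩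

variable [IsDomain R] [IsFractionRing R F] [IsIntegrallyClosed R] {p : ℕ} [hp : Fact p.Prime]

/-- Modulo `N` the sum of the images of `b` under the power maps is the constant `p * b.coeff 1`. It
is integral, and `F` embeds in the nonzero ring `F[G]/(N)`, so integral closedness of `R` applies.
-/
theorem exists_mul_coeff_one_eq (hG : Nat.card G = p) {b : MonoidAlgebra F G}
    (hb : IsIntegral R b) : ∃ r, algebraMap R F r = p * b.coeff 1 := by
  classical
  have : Nontrivial G := Finite.one_lt_card_iff_nontrivial.1 (hG ▸ hp.out.one_lt)
  obtain ⟨g, hg⟩ := exists_ne (1 : G)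
  refine IsIntegrallyClosed.isIntegral_iff.1 ?_
  let q : MonoidAlgebra F G →ₐ[R] (MonoidAlgebra F G ⧸ Ideal.span {normElt F G}) :=
    (Ideal.Quotient.mkₐ F (Ideal.span {normElt F G})).restrictScalars R
  have h1 : IsIntegral R (∑ a ∈ Finset.range p, powHom F G a b) :=
    IsIntegral.sum _ fun a _ => hb.map ((powHom F G a).restrictScalars R)
  have h2 := h1.map q
  have h3 : q (∑ a ∈ Finset.range p, powHom F G a b) = algebraMap F _ ((p : F) * b.coeff 1) := by
    rw [sum_powHom hG, map_add]
    have : q ((aug F G b - b.coeff 1) • normElt F G) = 0 :=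
      Ideal.Quotient.eq_zero_iff_mem.2 (mem_span_normElt.2 ⟨_, rfl⟩)
    rw [this, add_zero]
    rfl
  rw [h3] at h2
  have hnt : Nontrivial (MonoidAlgebra F G ⧸ Ideal.span {normElt F G}) := by
    refine Ideal.Quotient.nontrivial_iff.2 fun h => ?_
    obtain ⟨c, hc⟩ := mem_span_normElt.1 ((Ideal.eq_top_iff_one _).1 h)
    have h5 := congrArg (fun z => z.coeff g) hc
    have h6 := congrArg (fun z => z.coeff 1) hc
    simp [coeff_normElt, one_def, Ne.symm hg] at h5 h6
    exact one_ne_zero (h6.trans h5.symm)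
  exact (isIntegral_algHom_iff (IsScalarTower.toAlgHom R F
    (MonoidAlgebra F G ⧸ Ideal.span {normElt F G})) (algebraMap F _).injective).1 h2

theorem isIntegral_single (g : G) : IsIntegral R (single g 1 : MonoidAlgebra F G) := by
  refine IsIntegral.of_pow (n := orderOf g) (orderOf_pos g) ?_
  rw [single_pow, pow_orderOf_eq_one, one_pow]
  exact isIntegral_one

theorem exists_incl_eq_nsmul (hG : Nat.card G = p) {b : MonoidAlgebra F G} (hb : IsIntegral R b) :
    ∃ x, incl R F G x = (p : MonoidAlgebra F G) * b := by
  have h : ∀ g, ∃ r, algebraMap R F r = p * b.coeff g := by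
    intro g
    obtain ⟨r, hr⟩ := exists_mul_coeff_one_eq hG (hb.mul (isIntegral_single (F := F) g⁻¹))
    refine ⟨r, hr.trans ?_⟩
    rw [coeff_mul_single_apply]
    simp
  choose r hr using h
  refine ⟨∑ g, single g (r g), ?_⟩
  classical
  rw [map_sum, ← map_natCast (algebraMap F (MonoidAlgebra F G)), ← Algebra.smul_def]
  ext g
  simp only [incl_single, hr, MonoidAlgebra.coeff_sum, Finsupp.finsetSum_apply, coeff_single,
    Finsupp.single_apply, Finset.sum_ite_eq', Finset.mem_univ, if_true, MonoidAlgebra.coeff_smul,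
    Finsupp.smul_apply, smul_eq_mul]

/-- Division by `π = g - 1` stays inside `R[G]` modulo `N`. An integral equation for `b`, with roots
scaled by `π`, gives one for `x`; the augmentation kills `π` and leaves a power of `aug x` in `(p)`.
Radicality puts `aug x` in `(p)`, so after subtracting a multiple of `N` the element `x` is
divisible by `π`. -/
theorem exists_sub_incl_mem_of_mul (hrad : (Ideal.span {(p : R)}).IsRadical)
    [CharZero F] (hG : Nat.card G = p) {g : G} (hg : ∀ x, x ∈ Subgroup.zpowers g)
    {b : MonoidAlgebra F G} (hb : IsIntegral R b) {x : MonoidAlgebra R G}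
    (hx : (single g 1 - 1) * b - incl R F G x ∈ Ideal.span {normElt F G}) :
    ∃ y, b - incl R F G y ∈ Ideal.span {normElt F G} := by
  obtain ⟨f, hf, hfb⟩ := hb
  set π : MonoidAlgebra R G := single g 1 - 1 with hπ
  have hπ' : incl R F G π = single g 1 - 1 := by
    rw [hπ, map_sub, incl_single, map_one, map_one]
  have haugπ : aug R G π = 0 := by rw [hπ, map_sub, aug_single, map_one, sub_self]
  set q := (f.map (algebraMap R (MonoidAlgebra R G))).scaleRoots π with hq
  have h1 : eval₂ (incl R F G).toRingHom (incl R F G π * b) q = 0 := by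
    refine scaleRoots_eval₂_eq_zero (incl R F G).toRingHom ?_
    rw [eval₂_map]
    rw [← hfb]
    congr 1
    exact RingHom.ext fun r => (incl R F G).commutes r
  have h2 : incl R F G (q.eval x) ∈ Ideal.span {normElt F G} := by
    rw [← Ideal.Quotient.eq_zero_iff_mem]
    have h3 := congrArg (Ideal.Quotient.mk (Ideal.span {normElt F G})) h1
    rw [hom_eval₂, map_zero, hπ', Ideal.Quotient.eq.2 hx] at h3
    rw [← h3]
    change ((Ideal.Quotient.mk (Ideal.span {normElt F G})).comp (incl R F G).toRingHom) (q.eval x) = _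
    rw [← eval₂_id, hom_eval₂, RingHom.comp_id]
    rfl
  have hfs : FaithfulSMul R F := inferInstance
  obtain ⟨c, hc⟩ := mem_span_normElt.1 (mem_span_normElt_of_incl_mem h2)
  have h4 : aug R G x ^ f.natDegree = c * p := by
    have h5 := congrArg (aug R G) hc
    rw [map_smul, aug_normElt, hG, smul_eq_mul] at h5
    rw [← h5]
    change _ = (aug R G).toRingHom (q.eval x)
    rw [← eval₂_id, hom_eval₂, RingHom.comp_id, ← eval_map, hq,
      map_scaleRoots _ _ _ (by simp [(hf.map _).leadingCoeff]), Polynomial.map_map]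
    have : ((aug R G).toRingHom.comp (algebraMap R (MonoidAlgebra R G))) = RingHom.id R :=
      RingHom.ext fun r => (aug R G).commutes r
    rw [this, Polynomial.map_id]
    change _ = eval (aug R G x) (f.scaleRoots (aug R G π))
    rw [haugπ, scaleRoots_zero, hf.leadingCoeff, one_smul, eval_pow, eval_X]
  obtain ⟨r, hr⟩ := Ideal.mem_span_singleton'.1 (hrad ⟨f.natDegree,
    (Ideal.mem_span_singleton'.2 ⟨c, h4.symm⟩)⟩ : aug R G x ∈ Ideal.span {(p : R)})
  have h6 : x - r • normElt R G ∈ Ideal.span {π} := by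
    rw [hπ, ← ker_aug hg, RingHom.mem_ker, map_sub, map_smul, aug_normElt, hG, smul_eq_mul, hr,
      sub_self]
  obtain ⟨y, hy⟩ := Ideal.mem_span_singleton'.1 h6
  refine ⟨y, mem_span_normElt_of_mul_eq_zero hg ?_⟩
  have h7 : (single g 1 - 1) * (b - incl R F G y) ∈ Ideal.span {normElt F G} := by
    have h8 := congrArg (incl R F G) hy
    rw [map_mul, hπ', map_sub, map_smul, incl_normElt] at h8
    have h9 : (single g 1 - 1) * (b - incl R F G y) =
        ((single g 1 - 1) * b - incl R F G x) + r • normElt F G := by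
      linear_combination -h8
    rw [h9]
    exact Ideal.add_mem _ hx (mem_span_normElt.2 ⟨algebraMap R F r, by rw [algebraMap_smul]⟩)
  obtain ⟨s, hs⟩ := mem_span_normElt.1 h7
  -- The remaining multiple `s` of `N` must vanish: the left side has augmentation `0`, the right
  -- side `s * p`, and `p ≠ 0` in `F`.
  have h10 := congrArg (aug F G) hs
  rw [map_mul, map_sub, aug_single, map_one, sub_self, zero_mul, map_smul, aug_normElt, hG,
    smul_eq_mul] at h10
  have hp0 : (p : F) ≠ 0 := Nat.cast_ne_zero.2 hp.out.ne_zero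
  rw [hs, (mul_eq_zero.1 h10.symm).resolve_right hp0, zero_smul]

/-- Since `p * b` has coefficients in `R` and `p` divides `(g - 1)^p`, some power of `g - 1` carries
`b` into `R[G]`. The factors `g - 1` are then removed one at a time. -/
theorem exists_sub_incl_mem_span_normElt (hrad : (Ideal.span {(p : R)}).IsRadical)
    [CharZero F] (hG : Nat.card G = p) {g : G} (hg : ∀ x, x ∈ Subgroup.zpowers g)
    {b : MonoidAlgebra F G} (hb : IsIntegral R b) :
    ∃ y, b - incl R F G y ∈ Ideal.span {normElt F G} := by
  have step : ∀ (m : ℕ) (b : MonoidAlgebra F G), IsIntegral R b →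
      (∃ x, (single g 1 - 1) ^ m * b = incl R F G x) →
      ∃ y, b - incl R F G y ∈ Ideal.span {normElt F G} := by
    intro m
    induction m with
    | zero =>
      rintro b - ⟨x, hx⟩
      refine ⟨x, ?_⟩
      rw [← hx, pow_zero, one_mul, sub_self]
      exact Ideal.zero_mem _
    | succ m ih =>
      rintro b hb ⟨x, hx⟩
      obtain ⟨y, hy⟩ := ih ((single g 1 - 1) * b)
        (((isIntegral_single g).sub isIntegral_one).mul hb) ⟨x, by rw [← hx]; ring⟩
      exact exists_sub_incl_mem_of_mul hrad hG hg hb hy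
  obtain ⟨x, hx⟩ := exists_incl_eq_nsmul hG hb
  have h1 : ∃ z : MonoidAlgebra R G, (single g 1 - 1) ^ p = (p : MonoidAlgebra R G) * z := by
    have h2 : ((p : ℕ) : MonoidAlgebra R G) ∣ (single g 1 - 1) ^ p := by
      obtain ⟨z, hz⟩ := exists_add_pow_prime_eq hp.out ((single g 1 - 1 : MonoidAlgebra R G)) 1
      rw [sub_add_cancel, single_pow, one_pow, ← hG, pow_card_eq_one', ← one_def, one_pow, hG] at hz
      exact ⟨-((single g 1 - 1) * 1 * z), by linear_combination -hz⟩
    exact h2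
  obtain ⟨z, hz⟩ := h1
  refine step p b hb ⟨z * x, ?_⟩
  have h3 := congrArg (incl R F G) hz
  rw [map_pow, map_sub, incl_single, map_one, map_one, map_mul, map_natCast] at h3
  rw [h3, map_mul, hx]
  ring

theorem exists_sub_incl_mem_ker_aug {b : MonoidAlgebra F G} (hb : IsIntegral R b) :
    ∃ y, b - incl R F G y ∈ RingHom.ker (aug F G) := by
  obtain ⟨r, hr⟩ := IsIntegrallyClosed.isIntegral_iff.1 (isIntegral_aug hb)
  exact ⟨algebraMap R _ r, by rw [RingHom.mem_ker, map_sub, aug_incl, AlgHom.commutes, ← hr]; exact sub_self _⟩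

end integral

end CyclicGroupRing

end

/-! ### The kernel group of `R[G]` as a quotient of the units of `R / p`. -/

noncomputable section

set_option linter.unusedSectionVars false

namespace CyclicGroupRing

open MonoidAlgebra LocallyFree MilnorSquare

theorem nonempty_algHom_of_exists {Λ B C D : Type*} [CommRing Λ] [CommRing B] [CommRing C]
    [CommRing D] [Algebra Λ B] [Algebra Λ C] [Algebra Λ D] (h : B →ₐ[Λ] D) (i : C →ₐ[Λ] D)
    (hi : Function.Injective i) (H : ∀ b, ∃ c, i c = h b) : Nonempty (B →ₐ[Λ] C) :=
  ⟨(AlgEquiv.ofInjective i hi).symm.toAlgHom.comp (h.codRestrict i.range H)⟩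

section

variable (R : Type u) [CommRing R] [IsDomain R] [IsIntegrallyClosed R]
  (F : Type u) [Field F] [CharZero F] [Algebra R F] [IsFractionRing R F]
  (G : Type v) [CommGroup G] [Fintype G] {p : ℕ} [hp : Fact p.Prime]

variable {R G} in
theorem ker_aug_inf_span [CharZero R] :
    RingHom.ker (aug R G) ⊓ Ideal.span {normElt R G} = ⊥ := by
  refine eq_bot_iff.2 ?_
  rintro x ⟨hx, hx'⟩
  obtain ⟨c, rfl⟩ := mem_span_normElt.1 hx'
  have h : aug R G (c • normElt R G) = 0 := hx
  rw [map_smul, aug_normElt, smul_eq_mul] at h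
  rw [(mul_eq_zero.1 h).resolve_right (Nat.cast_ne_zero.2 Nat.card_pos.ne'), zero_smul]
  exact Submodule.zero_mem _

variable {R G} in
-- The augmentation kills `I` and sends `cN` to `cp`; conversely `cp = (cp - cN) + cN`. This
-- identifies the common quotient with `R / p`.
theorem algebraMap_mem_sup_iff (hG : Nat.card G = p) {r : R} :
    algebraMap R (MonoidAlgebra R G) r ∈ RingHom.ker (aug R G) ⊔ Ideal.span {normElt R G} ↔
      r ∈ Ideal.span {(p : R)} := by
  rw [Ideal.mem_span_singleton']
  constructor
  · intro h
    obtain ⟨x, hx, y, hy, hxy⟩ := Submodule.mem_sup.1 h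
    obtain ⟨c, rfl⟩ := mem_span_normElt.1 hy
    have := congrArg (aug R G) hxy
    rw [map_add, RingHom.mem_ker.1 hx, map_smul, aug_normElt, hG, zero_add, AlgHom.commutes] at this
    exact ⟨c, this⟩
  · rintro ⟨c, rfl⟩
    refine Submodule.mem_sup.2 ⟨algebraMap R _ (c * p) - c • normElt R G, ?_, c • normElt R G,
      mem_span_normElt.2 ⟨c, rfl⟩, sub_add_cancel _ _⟩
    rw [RingHom.mem_ker, map_sub, AlgHom.commutes, map_smul, aug_normElt, hG,
      Algebra.algebraMap_self_apply, smul_eq_mul, sub_self]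

variable {R G} in
theorem span_le_comap_sup (hG : Nat.card G = p) : Ideal.span {(p : R)} ≤
    (RingHom.ker (aug R G) ⊔ Ideal.span {normElt R G}).comap (algebraMap R (MonoidAlgebra R G)) :=
  fun _ h => (algebraMap_mem_sup_iff hG).2 h

variable {R G} in
theorem mk_algebraMap_aug (K : Ideal (MonoidAlgebra R G)) (x : MonoidAlgebra R G) :
    Ideal.Quotient.mk (RingHom.ker (aug R G) ⊔ K) (algebraMap R _ (aug R G x)) =
      Ideal.Quotient.mk (RingHom.ker (aug R G) ⊔ K) x := by
  have h : algebraMap R _ (aug R G x) - x ∈ RingHom.ker (aug R G) := by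
    rw [RingHom.mem_ker, map_sub, AlgHom.commutes, Algebra.algebraMap_self_apply, sub_self]
  exact Ideal.Quotient.eq.2 (Ideal.mem_sup_left h)

/-- The reduction map from `R / p` to `R[G] / (ker aug + (∑ g))`. -/
def quotientMap (hG : Nat.card G = p) : (R ⧸ Ideal.span {(p : R)}) →+*
    (MonoidAlgebra R G ⧸ (RingHom.ker (aug R G) ⊔ Ideal.span {normElt R G})) :=
  Ideal.quotientMap _ (algebraMap R (MonoidAlgebra R G)) (span_le_comap_sup hG)

theorem quotientMap_mk (hG : Nat.card G = p) (r : R) :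
    quotientMap R G hG (Ideal.Quotient.mk _ r) =
      Ideal.Quotient.mk _ (algebraMap R (MonoidAlgebra R G) r) :=
  Ideal.quotientMap_mk

theorem quotientMap_mk_aug (hG : Nat.card G = p) (x : MonoidAlgebra R G) :
    quotientMap R G hG (Ideal.Quotient.mk _ (aug R G x)) = Ideal.Quotient.mk _ x :=
  (quotientMap_mk R G hG _).trans (mk_algebraMap_aug _ x)

theorem quotientMap_bijective (hG : Nat.card G = p) : Function.Bijective (quotientMap R G hG) := by
  constructor
  · rw [injective_iff_map_eq_zero]
    intro y hy
    obtain ⟨r, rfl⟩ := Ideal.Quotient.mk_surjective y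
    rw [quotientMap_mk, Ideal.Quotient.eq_zero_iff_mem] at hy
    exact Ideal.Quotient.eq_zero_iff_mem.2 ((algebraMap_mem_sup_iff hG).1 hy)
  · intro x
    obtain ⟨x, rfl⟩ := Ideal.Quotient.mk_surjective x
    exact ⟨_, quotientMap_mk_aug R G hG x⟩

/-- The common quotient `R / p` of `R[G] / ker aug` and `R[G] / (∑ g)`. -/
def quotientEquiv (hG : Nat.card G = p) : (R ⧸ Ideal.span {(p : R)}) ≃+*
    (MonoidAlgebra R G ⧸ (RingHom.ker (aug R G) ⊔ Ideal.span {normElt R G})) :=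
  RingEquiv.ofBijective (quotientMap R G hG) (quotientMap_bijective R G hG)

theorem quotientEquiv_mk (hG : Nat.card G = p) (r : R) :
    quotientEquiv R G hG (Ideal.Quotient.mk _ r) =
      Ideal.Quotient.mk _ (algebraMap R (MonoidAlgebra R G) r) := quotientMap_mk R G hG r

theorem quotientEquiv_mk_aug (hG : Nat.card G = p) (x : MonoidAlgebra R G) :
    quotientEquiv R G hG (Ideal.Quotient.mk _ (aug R G x)) = Ideal.Quotient.mk _ x :=
  quotientMap_mk_aug R G hG x

variable {R F G}

/-- By `H` the image of the maximal order in `F[G]/K'` lies in that of `R[G]/K`, which embeds there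
by `h`. Used for both corners of the square. -/
theorem nonempty_maximalOrder_algHom {K : Ideal (MonoidAlgebra R G)}
    {K' : Ideal (MonoidAlgebra F G)} (h : ∀ x, incl R F G x ∈ K' ↔ x ∈ K)
    (H : ∀ b : MonoidAlgebra F G, IsIntegral R b → ∃ y, b - incl R F G y ∈ K') :
    Nonempty (MaximalOrder R F G →ₐ[MonoidAlgebra R G] MonoidAlgebra R G ⧸ K) := by
  let _ : Algebra (MonoidAlgebra R G) (MonoidAlgebra F G ⧸ K') :=
    ((Ideal.Quotient.mk K').comp (incl R F G).toRingHom).toAlgebra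
  let f : MaximalOrder R F G →ₐ[MonoidAlgebra R G] MonoidAlgebra F G ⧸ K' :=
    { (Ideal.Quotient.mk K').comp (MaximalOrder R F G).val.toRingHom with
      commutes' := fun _ => rfl }
  let i : (MonoidAlgebra R G ⧸ K) →ₐ[MonoidAlgebra R G] MonoidAlgebra F G ⧸ K' :=
    { Ideal.quotientMap K' (incl R F G).toRingHom (fun x hx => (h x).2 hx) with
      commutes' := fun _ => rfl }
  refine nonempty_algHom_of_exists f i
    (Ideal.quotientMap_injective' (f := (incl R F G).toRingHom)
      (H := fun x hx => (h x).2 hx) fun x hx => (h x).1 hx) fun b => ?_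
  obtain ⟨y, hy⟩ := H b.1 b.2
  exact ⟨Ideal.Quotient.mk K y, (Ideal.Quotient.eq.2 hy).symm⟩

/-- Multiplication by `p` embeds the maximal order in the image of `R[G]`, which is finite over the
Noetherian ring `R`. -/
theorem finite_maximalOrder [IsNoetherianRing R] (hG : Nat.card G = p) :
    Module.Finite R (MaximalOrder R F G) := by
  let m : MaximalOrder R F G →ₗ[R] LinearMap.range (incl R F G).toLinearMap :=
    ((LinearMap.mulLeft R (p : MonoidAlgebra F G)).comp (MaximalOrder R F G).val.toLinearMap).codRestrict
      _ fun b => exists_incl_eq_nsmul hG b.2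
  refine Module.Finite.of_injective m fun b c h => Subtype.ext ?_
  have h1 : (p : MonoidAlgebra F G) * b.1 = p * c.1 := congrArg Subtype.val h
  have h2 : (p : F) • b.1 = (p : F) • c.1 := by
    rw [Algebra.smul_def, Algebra.smul_def, map_natCast]
    exact h1
  exact smul_right_injective _ (Nat.cast_ne_zero.2 hp.out.ne_zero : (p : F) ≠ 0) h2

/-- The idempotent of the maximal order defined by the trivial character. -/
theorem exists_idempotent (hG : Nat.card G = p) : ∃ e : MaximalOrder R F G, e * e = e ∧
    (∀ c ∈ RingHom.ker (aug R G), e * algebraMap (MonoidAlgebra R G) _ c = 0) ∧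
    ∀ c ∈ Ideal.span {normElt R G}, (1 - e) * algebraMap (MonoidAlgebra R G) _ c = 0 := by
  have hp0 : (p : F) ≠ 0 := Nat.cast_ne_zero.2 hp.out.ne_zero
  have hid : ((p : F)⁻¹ • normElt F G) * ((p : F)⁻¹ • normElt F G) = (p : F)⁻¹ • normElt F G := by
    rw [mul_smul_comm, mul_normElt, map_smul, aug_normElt, hG, smul_eq_mul, inv_mul_cancel₀ hp0,
      one_smul]
  have hint : IsIntegral R ((p : F)⁻¹ • normElt F G) := by
    refine ⟨Polynomial.X ^ 2 - Polynomial.X, ?_, ?_⟩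
    · monicity!
    · rw [Polynomial.eval₂_sub, Polynomial.eval₂_pow, Polynomial.eval₂_X, pow_two, hid, sub_self]
  have halg : ∀ c, (algebraMap (MonoidAlgebra R G) (MaximalOrder R F G) c).1 = incl R F G c :=
    fun _ => rfl
  refine ⟨⟨_, hint⟩, Subtype.ext hid, fun c hc => Subtype.ext ?_, fun c hc => Subtype.ext ?_⟩
  · rw [MulMemClass.coe_mul, halg, smul_mul_assoc, mul_comm, mul_normElt, aug_incl,
      RingHom.mem_ker.1 hc, map_zero, zero_smul, smul_zero]
    rfl
  · obtain ⟨r, rfl⟩ := mem_span_normElt.1 hc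
    rw [MulMemClass.coe_mul, halg, AddSubgroupClass.coe_sub, OneMemClass.coe_one, map_smul,
      incl_normElt, mul_smul_comm, sub_mul, one_mul, smul_mul_assoc, mul_normElt,
      aug_normElt, hG, smul_smul, inv_mul_cancel₀ hp0, one_smul, sub_self, smul_zero]
    rfl

/-- If a lift `r` of `u` lies in `P`, then `p ∉ P`, since otherwise the unit relation mod `p` would
put `1` in `P`; so `r + p` is a lift outside `P`. This is the input for local freeness of the lines.
-/
theorem exists_notMem_mk_eq (hG : Nat.card G = p)
    (u : (MonoidAlgebra R G ⧸ (RingHom.ker (aug R G) ⊔ Ideal.span {normElt R G}))ˣ)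
    (P : Ideal R) [hP : P.IsMaximal] :
    ∃ r ∉ P, Ideal.Quotient.mk _ (algebraMap R (MonoidAlgebra R G) r) = u.1 := by
  obtain ⟨r, hr⟩ : ∃ r, quotientEquiv R G hG (Ideal.Quotient.mk _ r) = u.1 := by
    obtain ⟨x, hx⟩ := (quotientEquiv R G hG).surjective u.1
    obtain ⟨r, rfl⟩ := Ideal.Quotient.mk_surjective x
    exact ⟨r, hx⟩
  by_cases hrP : r ∈ P
  · refine ⟨r + p, fun h => ?_, ?_⟩
    · have hpP : (p : R) ∈ P := (Ideal.add_mem_iff_right _ hrP).1 h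
      obtain ⟨s, hs⟩ : ∃ s, quotientEquiv R G hG (Ideal.Quotient.mk _ s) = u⁻¹.1 := by
        obtain ⟨x, hx⟩ := (quotientEquiv R G hG).surjective u⁻¹.1
        obtain ⟨r, rfl⟩ := Ideal.Quotient.mk_surjective x
        exact ⟨r, hx⟩
      have h1 : quotientEquiv R G hG (Ideal.Quotient.mk _ (r * s)) =
          quotientEquiv R G hG (Ideal.Quotient.mk _ 1) := by
        rw [map_mul, map_mul, hr, hs, u.mul_inv, map_one, map_one]
      have h2 := Ideal.Quotient.eq.1 ((quotientEquiv R G hG).injective h1)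
      have h3 : r * s - 1 ∈ P := (Ideal.span_singleton_le_iff_mem _).2 hpP h2
      have h4 : (1 : R) ∈ P := by
        have := P.sub_mem (P.mul_mem_right s hrP) h3
        rwa [sub_sub_cancel] at this
      exact hP.ne_top ((Ideal.eq_top_iff_one _).2 h4)
    · rw [← hr, quotientEquiv_mk, Ideal.Quotient.eq, ← map_sub, algebraMap_mem_sup_iff hG,
        add_sub_cancel_left]
      exact Ideal.mem_span_singleton_self _
  · exact ⟨r, hrP, hr⟩

/-- `lineHom` transported along `R / p ≅ Λ / (I + J)`. In the description of the kernel, `a` is a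
unit of `Λ / I ≅ R`, while `x` and `y` lift a unit of `Λ / J` and its inverse. -/
theorem exists_kernelGroup_hom [IsNoetherianRing R] [IsCyclic G] (hG : Nat.card G = p)
    (hrad : (Ideal.span {(p : R)}).IsRadical)
    (hdiag : IsDiagonalizableByTransvections (R ⧸ Ideal.span {(p : R)})) :
    ∃ φ : Additive (R ⧸ Ideal.span {(p : R)})ˣ →+ Cl R (MonoidAlgebra R G),
      φ.range = KernelGroup R F G ∧ ∀ u : (R ⧸ Ideal.span {(p : R)})ˣ,
        φ (Additive.ofMul u) = 0 ↔ ∃ (a : Rˣ) (x y : MonoidAlgebra R G),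
          x * y - 1 ∈ Ideal.span {normElt R G} ∧
          Ideal.Quotient.mk _ (a : R) = Ideal.Quotient.mk _ (aug R G x) * u.1 := by
  have hR : CharZero R := (algebraMap R F).charZero_iff (IsFractionRing.injective R F) |>.2 inferInstance
  obtain ⟨g, hg⟩ := IsCyclic.exists_generator (α := G)
  have hp0 : (p : R) ≠ 0 := Nat.cast_ne_zero.2 hp.out.ne_zero
  let I := RingHom.ker (aug R G)
  let J := Ideal.span {normElt R G}
  have hIJ : I ⊓ J = ⊥ := ker_aug_inf_span
  have hNJ : normElt R G ∈ J := Ideal.mem_span_singleton_self _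
  have hπI : single g 1 - 1 ∈ I := by
    rw [RingHom.mem_ker, map_sub, aug_single, map_one, sub_self]
  let E := quotientEquiv R G hG
  have : IsNoetherianRing (MonoidAlgebra R G) := IsNoetherianRing.of_finite R _
  have : Module.Finite R (MaximalOrder R F G) := finite_maximalOrder hG
  have hnt : Nontrivial (MonoidAlgebra R G ⧸ I) := Ideal.Quotient.nontrivial_iff.2 fun h => by
    have : aug R G 1 = 0 := (Ideal.eq_top_iff_one _).1 h
    rw [map_one] at this
    exact one_ne_zero this
  have hu : ∀ u : (MonoidAlgebra R G ⧸ (I ⊔ J))ˣ, IsLocallyFree R (MonoidAlgebra R G) (line u.1) :=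
    fun u => isLocallyFree_line hIJ fun P _ => exists_notMem_mk_eq hG u P
  have hJ : ∀ a : MonoidAlgebra R G ⧸ I, (∀ c ∈ J, c • a = 0) → a = 0 := by
    intro a ha
    obtain ⟨x, rfl⟩ := Ideal.Quotient.mk_surjective a
    have h1 : normElt R G * x ∈ I := Ideal.Quotient.eq_zero_iff_mem.1 (ha _ hNJ)
    rw [RingHom.mem_ker, map_mul, aug_normElt, hG] at h1
    exact Ideal.Quotient.eq_zero_iff_mem.2 ((mul_eq_zero.1 h1).resolve_left hp0)
  have hI : ∀ b : MonoidAlgebra R G ⧸ J, (∀ c ∈ I, c • b = 0) → b = 0 := by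
    intro b hb
    obtain ⟨x, rfl⟩ := Ideal.Quotient.mk_surjective b
    have h1 : (single g 1 - 1) * x ∈ J := Ideal.Quotient.eq_zero_iff_mem.1 (hb _ hπI)
    obtain ⟨c, hc⟩ := mem_span_normElt.1 h1
    have h2 := congrArg (aug R G) hc
    rw [map_mul, RingHom.mem_ker.1 hπI, zero_mul, map_smul, aug_normElt, hG, smul_eq_mul] at h2
    rw [(mul_eq_zero.1 h2.symm).resolve_right hp0, zero_smul] at hc
    exact Ideal.Quotient.eq_zero_iff_mem.2 (mem_span_normElt_of_mul_eq_zero hg hc)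
  obtain ⟨f₁⟩ := nonempty_maximalOrder_algHom (R := R) (F := F) (G := G) (K := I)
    (K' := RingHom.ker (aug F G)) (fun x => by
      rw [RingHom.mem_ker, RingHom.mem_ker, aug_incl, FaithfulSMul.algebraMap_eq_zero_iff])
    fun b hb => exists_sub_incl_mem_ker_aug hb
  obtain ⟨f₂⟩ := nonempty_maximalOrder_algHom (R := R) (F := F) (G := G) (K := J)
    (K' := Ideal.span {normElt F G}) (fun x => ⟨mem_span_normElt_of_incl_mem, fun hx => by
      obtain ⟨c, rfl⟩ := mem_span_normElt.1 hx
      rw [map_smul, incl_normElt]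
      exact mem_span_normElt.2 ⟨algebraMap R F c, by rw [algebraMap_smul]⟩⟩)
    fun b hb => exists_sub_incl_mem_span_normElt hrad hG hg hb
  obtain ⟨e, he, heI, heJ⟩ := exists_idempotent (R := R) (F := F) hG
  have hdiag' : IsDiagonalizableByTransvections (MonoidAlgebra R G ⧸ (I ⊔ J)) :=
    hdiag.of_surjective E.toRingHom E.surjective
  let ψ : Additive (R ⧸ Ideal.span {(p : R)})ˣ →+ Additive (MonoidAlgebra R G ⧸ (I ⊔ J))ˣ :=
    MonoidHom.toAdditive (Units.map E.toRingHom.toMonoidHom)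
  have hψ : Function.Surjective ψ := (Units.mapEquiv E.toMulEquiv).surjective
  refine ⟨(lineHom hIJ hu).comp ψ, ?_, fun u => ?_⟩
  · rw [AddMonoidHom.range_comp, AddMonoidHom.range_eq_top.2 hψ, ← AddMonoidHom.range_eq_map]
    exact range_lineHom hIJ hu hdiag' f₁ f₂ he heI heJ
  · refine (lineHom_eq_zero_iff hIJ hu hJ hI (Units.map E.toRingHom.toMonoidHom u)).trans ?_
    have hmk : ∀ x : MonoidAlgebra R G, E (Ideal.Quotient.mk _ (aug R G x)) = Ideal.Quotient.mk _ x :=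
      quotientEquiv_mk_aug R G hG
    constructor
    · rintro ⟨a, b, h⟩
      obtain ⟨a', ha⟩ := Ideal.Quotient.mk_surjective a.1
      obtain ⟨a'', ha'⟩ := Ideal.Quotient.mk_surjective a⁻¹.1
      obtain ⟨x, hx⟩ := Ideal.Quotient.mk_surjective b.1
      obtain ⟨y, hy⟩ := Ideal.Quotient.mk_surjective b⁻¹.1
      have h1 : aug R G a' * aug R G a'' = 1 := by
        have : Ideal.Quotient.mk I (a' * a'') = Ideal.Quotient.mk I 1 := by
          rw [map_mul, ha, ha', a.mul_inv, map_one]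
        have := RingHom.mem_ker.1 (Ideal.Quotient.eq.1 this)
        rwa [map_sub, map_mul, map_one, sub_eq_zero] at this
      refine ⟨⟨_, _, h1, (mul_comm _ _).trans h1⟩, x, y, ?_, E.injective ?_⟩
      · exact Ideal.Quotient.eq.1 (by rw [map_mul, hx, hy, b.mul_inv, map_one])
      · rw [map_mul, hmk, hmk]
        rw [← ha, ← hx] at h
        exact h
    · rintro ⟨a, x, y, hxy, h⟩
      have h1 : Ideal.Quotient.mk J x * Ideal.Quotient.mk J y = 1 := by
        rw [← map_mul, ← map_one (Ideal.Quotient.mk J)]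
        exact Ideal.Quotient.eq.2 hxy
      refine ⟨Units.map (algebraMap R (MonoidAlgebra R G ⧸ I)).toMonoidHom a,
        ⟨_, _, h1, (mul_comm _ _).trans h1⟩, ?_⟩
      have h2 := congrArg E h
      rw [map_mul, hmk] at h2
      exact h2

end

end CyclicGroupRing

end

/-! ### Units and residue rings of imaginary quadratic fields. -/

namespace ImaginaryQuadratic

variable {d : ℕ} {K : Type u} [Field K] [NumberField K] {α : K}

theorem irreducible_X_sq_add (hd : 0 < d) :
    Irreducible (Polynomial.X ^ 2 + Polynomial.C (d : ℚ)) := by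
  have hdeg : (Polynomial.X ^ 2 + Polynomial.C (d : ℚ)).natDegree = 2 := by compute_degree!
  refine (Polynomial.irreducible_iff_roots_eq_zero_of_degree_le_three hdeg.ge
    (hdeg.le.trans (by norm_num))).2 (Multiset.eq_zero_of_forall_notMem fun x hx => ?_)
  have h := (Polynomial.mem_roots'.1 hx).2
  have hd' : (0 : ℚ) < d := Nat.cast_pos.2 hd
  simp only [Polynomial.IsRoot, Polynomial.eval_add, Polynomial.eval_pow, Polynomial.eval_X,
    Polynomial.eval_C] at h
  nlinarith [sq_nonneg x]

theorem finrank_eq_two (hd : 0 < d) (hα : α ^ 2 = -(d : K))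
    (hK : IntermediateField.adjoin ℚ {α} = ⊤) : Module.finrank ℚ K = 2 := by
  have hmin : Polynomial.X ^ 2 + Polynomial.C (d : ℚ) = minpoly ℚ α :=
    minpoly.eq_of_irreducible_of_monic (irreducible_X_sq_add hd) (by simp [hα])
      (by monicity!)
  rw [← IntermediateField.finrank_top', ← hK,
    IntermediateField.adjoin.finrank (Algebra.IsIntegral.isIntegral α), ← hmin]
  compute_degree!

theorem exists_eq_add_mul (hα : α ^ 2 = -(d : K))
    (hK : IntermediateField.adjoin ℚ {α} = ⊤) (u : K) : ∃ x y : ℚ, u = x + y * α := by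
  have h : u ∈ Algebra.adjoin ℚ {α} := by
    rw [← IntermediateField.adjoin_simple_toSubalgebra_of_isAlgebraic
      (Algebra.IsAlgebraic.isAlgebraic α), hK]
    exact Algebra.mem_top
  induction h using Algebra.adjoin_induction with
  | mem x hx => exact ⟨0, 1, by rw [Set.mem_singleton_iff.1 hx]; simp⟩
  | algebraMap r => exact ⟨r, 0, by simp⟩
  | add x y _ _ hx hy =>
    obtain ⟨a, b, rfl⟩ := hx
    obtain ⟨a', b', rfl⟩ := hy
    exact ⟨a + a', b + b', by push_cast; ring⟩
  | mul x y _ _ hx hy =>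
    obtain ⟨a, b, rfl⟩ := hx
    obtain ⟨a', b', rfl⟩ := hy
    exact ⟨a * a' - d * (b * b'), a * b' + a' * b, by
      push_cast; linear_combination (b * b' : K) * hα⟩

theorem conj_eq_neg_of_sq_eq (hd : 0 < d) {w : ℂ} (hw : w ^ 2 = -(d : ℂ)) :
    (starRingEnd ℂ) w = -w := by
  have hd' : (0 : ℝ) < d := Nat.cast_pos.2 hd
  have h1 := congrArg Complex.re hw
  have h2 := congrArg Complex.im hw
  simp only [pow_two, Complex.mul_re, Complex.mul_im, Complex.neg_re, Complex.neg_im,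
    Complex.natCast_re, Complex.natCast_im] at h1 h2
  have h3 : w.re = 0 := by
    by_contra h
    have : w.im = 0 := by
      have : w.re * w.im = 0 := by linarith
      exact (mul_eq_zero.1 this).resolve_left h
    rw [this] at h1
    nlinarith [mul_self_nonneg w.re]
  apply Complex.ext <;> simp [h3]

theorem exists_intCast_eq_of_isIntegral {q : ℚ} (h : IsIntegral ℤ (q : ℂ)) : ∃ n : ℤ, (n : ℚ) = q := by
  have h' : IsIntegral ℤ q :=
    (isIntegral_algHom_iff ((algebraMap ℚ ℂ).toIntAlgHom) (algebraMap ℚ ℂ).injective).1 h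
  exact IsIntegrallyClosed.isIntegral_iff.1 h'

/-- The trace and the norm of an algebraic integer are integers. -/
theorem exists_trace_norm (hd : 0 < d) (hα : α ^ 2 = -(d : K)) {x y : ℚ}
    (h : IsIntegral ℤ (x + y * α : K)) :
    (∃ t : ℤ, (t : ℚ) = 2 * x) ∧ ∃ n : ℤ, (n : ℚ) = x ^ 2 + d * y ^ 2 := by
  obtain ⟨σ⟩ : Nonempty (K →+* ℂ) := inferInstance
  have hσ : σ α ^ 2 = -(d : ℂ) := by rw [← map_pow, hα, map_neg, map_natCast]
  have h1 : IsIntegral ℤ (σ (x + y * α)) := h.map σ.toIntAlgHom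
  have h2 : IsIntegral ℤ ((starRingEnd ℂ) (σ (x + y * α))) := h1.map (starRingEnd ℂ).toIntAlgHom
  rw [map_add, map_mul, map_ratCast, map_ratCast] at h1 h2
  rw [map_add, map_mul, map_ratCast, map_ratCast, conj_eq_neg_of_sq_eq hd hσ] at h2
  refine ⟨exists_intCast_eq_of_isIntegral ?_, exists_intCast_eq_of_isIntegral ?_⟩
  · have e : ((2 * x : ℚ) : ℂ) = (x + y * σ α) + (x + y * -σ α) := by
      push_cast
      ring
    rw [e]
    exact h1.add h2
  · have e : ((x ^ 2 + d * y ^ 2 : ℚ) : ℂ) = (x + y * σ α) * (x + y * -σ α) := by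
      push_cast
      linear_combination (y ^ 2 : ℂ) * hσ
    rw [e]
    exact h1.mul h2

/-- A unit `x + yα` has norm `1`, so its trace `t` satisfies `t² + d(2y)² = 4` and `|t| ≤ 2`. The
case `t = 0` makes `d` a square and `t = ±1` makes `3d` a square, which for squarefree `d` means `d
= 1` or `d = 3`. So `t = ±2` and `y = 0`. -/
theorem units_eq_one_or_neg_one (hd : 0 < d) (hsq : Squarefree d) (hd1 : d ≠ 1) (hd3 : d ≠ 3)
    (hα : α ^ 2 = -(d : K)) (hK : IntermediateField.adjoin ℚ {α} = ⊤) (u : (𝓞 K)ˣ) :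
    (u : 𝓞 K) = 1 ∨ (u : 𝓞 K) = -1 := by
  obtain ⟨x, y, hu⟩ := exists_eq_add_mul hα hK ((u : 𝓞 K) : K)
  obtain ⟨x', y', hu'⟩ := exists_eq_add_mul hα hK (((u⁻¹ : (𝓞 K)ˣ) : 𝓞 K) : K)
  obtain ⟨⟨t, ht⟩, n, hn⟩ := exists_trace_norm (x := x) (y := y) hd hα
    (by rw [← hu]; exact (u : 𝓞 K).isIntegral_coe)
  obtain ⟨-, n', hn'⟩ := exists_trace_norm (x := x') (y := y') hd hα
    (by rw [← hu']; exact ((u⁻¹ : (𝓞 K)ˣ) : 𝓞 K).isIntegral_coe)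
  have hd' : (0 : ℚ) < d := Nat.cast_pos.2 hd
  have hmul : (x + y * α) * (x' + y' * α) = 1 := by
    rw [← hu, ← hu', ← map_mul, u.mul_inv, map_one]
  -- Multiplicativity of the norm, obtained by multiplying the relation `u * u⁻¹ = 1` in `ℂ` by its
  -- complex conjugate.
  have hnn : n * n' = 1 := by
    obtain ⟨σ⟩ : Nonempty (K →+* ℂ) := inferInstance
    have hσ : σ α ^ 2 = -(d : ℂ) := by rw [← map_pow, hα, map_neg, map_natCast]
    have h1 := congrArg σ hmul
    have h2 := congrArg (starRingEnd ℂ) h1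
    simp only [map_add, map_mul, map_ratCast, map_one, conj_eq_neg_of_sq_eq hd hσ] at h1 h2
    have h3 : (((n * n' : ℤ) : ℚ) : ℂ) = ((1 : ℚ) : ℂ) := by
      rw [Int.cast_mul, hn, hn']
      push_cast
      have h4 := congrArg₂ (· * ·) h1 h2
      simp only [mul_one] at h4
      linear_combination h4 + (x ^ 2 * y' ^ 2 + y ^ 2 * x' ^ 2 +
        y ^ 2 * y' ^ 2 * (d - σ α ^ 2)) * hσ
    exact_mod_cast h3
  have hn1 : x ^ 2 + d * y ^ 2 = 1 := by
    rcases Int.isUnit_iff.1 (IsUnit.of_mul_eq_one _ hnn) with h | h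
    · rw [← hn, h, Int.cast_one]
    · rw [h] at hn
      push_cast at hn
      nlinarith [sq_nonneg x, sq_nonneg y]
  have ht4 : (t : ℚ) ^ 2 + d * (2 * y) ^ 2 = 4 := by
    rw [ht]
    linear_combination 4 * hn1
  have ht' : t ^ 2 ≤ 4 := by
    have : (t : ℚ) ^ 2 ≤ 4 := by nlinarith [sq_nonneg (2 * y)]
    exact_mod_cast this
  have htl : -2 ≤ t := by nlinarith
  have htu : t ≤ 2 := by nlinarith
  have hsq1 : ¬ IsSquare (d : ℚ) := by
    rw [Rat.isSquare_natCast_iff]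
    rintro ⟨k, rfl⟩
    have := Nat.isUnit_iff.1 (hsq k dvd_rfl)
    exact hd1 (by rw [this])
  have hsq3 : ¬ IsSquare ((3 * d : ℕ) : ℚ) := by
    rw [Rat.isSquare_natCast_iff]
    rintro ⟨k, hk⟩
    obtain ⟨m, rfl⟩ : 3 ∣ k := by
      have : 3 ∣ k * k := ⟨d, hk.symm⟩
      exact (Nat.prime_three.dvd_mul.1 this).elim id id
    have hdm : d = m * m * 3 := by linarith
    have := Nat.isUnit_iff.1 (hsq m ⟨3, hdm⟩)
    exact hd3 (by rw [hdm, this])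
  have hy : ((t : ℤ) = 2 ∨ t = -2) := by
    by_contra! hne
    have : t = 0 ∨ t ^ 2 = 1 := by
      obtain h | h | h : t = -1 ∨ t = 0 ∨ t = 1 := by omega
      all_goals simp [h]
    rcases this with h | h
    · rw [h, Int.cast_zero] at ht4
      exact hsq1 ⟨d * y, by linear_combination (-d / 4 : ℚ) * ht4⟩
    · have h' : (t : ℚ) ^ 2 = 1 := by exact_mod_cast h
      refine hsq3 ⟨d * (2 * y), ?_⟩
      push_cast
      linear_combination (-d : ℚ) * ht4 + d * h'
  have hy0 : y = 0 := by
    have h4 : (t : ℚ) ^ 2 = 4 := by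
      rcases hy with h | h <;> norm_num [h]
    have : d * (2 * y) ^ 2 = 0 := by linear_combination ht4 - h4
    have := (mul_eq_zero.1 this).resolve_left hd'.ne'
    simpa using this
  rw [hy0, Rat.cast_zero, zero_mul, add_zero] at hu
  rcases hy with h | h <;> rw [h] at ht
  · have hx : x = 1 := by push_cast at ht; linarith
    exact Or.inl (NumberField.RingOfIntegers.ext (by rw [hu, hx]; simp))
  · have hx : x = -1 := by push_cast at ht; linarith
    exact Or.inr (NumberField.RingOfIntegers.ext (by rw [hu, hx]; simp))

theorem natCard_quotient_span (hd : 0 < d) (hα : α ^ 2 = -(d : K))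
    (hK : IntermediateField.adjoin ℚ {α} = ⊤) (n : ℕ) :
    Nat.card (𝓞 K ⧸ Ideal.span {(n : 𝓞 K)}) = n ^ 2 := by
  rw [← finrank_eq_two hd hα hK, ← NumberField.RingOfIntegers.rank]
  exact Ideal.absNorm_span_natCast n

end ImaginaryQuadratic

/-! ### Quotients of the unit groups of `F_p × F_p` and of the field with `p²` elements. -/

section finiteField

variable {p : ℕ} [hp : Fact p.Prime] {C : Type*} [AddCommGroup C]

theorem exists_natCast_eq_of_card_eq {A : Type*} [Ring A] (hA : Nat.card A = p) (x : A) :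
    ∃ a : ℕ, (a : A) = x := by
  have : Finite A := Nat.finite_of_card_ne_zero (hA ▸ hp.out.ne_zero)
  have : Fintype A := Fintype.ofFinite A
  let e := ZMod.ringEquivOfPrime A hp.out (Nat.card_eq_fintype_card.symm.trans hA)
  exact ⟨(e.symm x).val, by rw [← map_natCast e, ZMod.natCast_zmod_val, e.apply_symm_apply]⟩

theorem natCast_eq_zero_iff_of_card_eq {A : Type*} [Ring A] (hA : Nat.card A = p) (a : ℕ) :
    (a : A) = 0 ↔ p ∣ a := by
  have : Finite A := Nat.finite_of_card_ne_zero (hA ▸ hp.out.ne_zero)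
  have : Fintype A := Fintype.ofFinite A
  let e := ZMod.ringEquivOfPrime A hp.out (Nat.card_eq_fintype_card.symm.trans hA)
  rw [← map_natCast e, map_eq_zero_iff e e.injective, ZMod.natCast_eq_zero_iff]

/-- Integers fill the diagonal of `F_p × F_p`. Dividing `(v, w)` by the integer that reduces to `w`
moves it into the first factor without changing `φ`, so the cyclic group `A₁ˣ` of order `p - 1`
already surjects. -/
theorem exists_surjective_of_ringEquiv_prod {A A₁ A₂ : Type*} [CommRing A] [Field A₁] [Field A₂]
    [Finite A₁] (e : A ≃+* A₁ × A₂) (h₁ : Nat.card A₁ = p) (h₂ : Nat.card A₂ = p)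
    (φ : Additive Aˣ →+ C)
    (hφ : ∀ (a : ℕ) (u : Aˣ), u.1 = a → φ (Additive.ofMul u) = 0) :
    ∃ f : ZMod (p - 1) →+ φ.range, Function.Surjective f := by
  have hcard : Nat.card (Additive A₁ˣ) = p - 1 := by
    rw [Nat.card_congr Additive.toMul, Nat.card_units, h₁]
  have := hcard ▸ zmodAddCyclicAddEquiv (G := Additive A₁ˣ) inferInstance
  let E : (A₁ × A₂)ˣ →* Aˣ := Units.map e.symm.toRingHom.toMonoidHom
  let i : A₁ˣ →* Aˣ := E.comp (MulEquiv.prodUnits.symm.toMonoidHom.comp (MonoidHom.inl A₁ˣ A₂ˣ))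
  refine ⟨(φ.rangeRestrict.comp (MonoidHom.toAdditive i)).comp this.toAddMonoidHom, ?_⟩
  refine Function.Surjective.comp (g := φ.rangeRestrict.comp (MonoidHom.toAdditive i)) ?_
    this.surjective
  rintro ⟨_, u, rfl⟩
  obtain ⟨u, rfl⟩ := Additive.ofMul.surjective u
  obtain ⟨w, rfl⟩ : ∃ w, E w = u := (Units.mapEquiv e.symm.toMulEquiv).surjective u
  obtain ⟨⟨v, w⟩, rfl⟩ := MulEquiv.prodUnits.symm.surjective w
  obtain ⟨a, ha⟩ := exists_natCast_eq_of_card_eq h₂ w.1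
  have ha0 : (a : A₁) ≠ 0 := fun h => w.ne_zero <| by
    rw [← ha, natCast_eq_zero_iff_of_card_eq h₂]
    exact (natCast_eq_zero_iff_of_card_eq h₁ a).1 h
  let m := Units.mk0 (a : A₁) ha0
  have hm : φ (Additive.ofMul (E (MulEquiv.prodUnits.symm (m, w)))) = 0 := by
    refine hφ a _ ?_
    change e.symm (m.1, w.1) = a
    rw [e.symm_apply_eq, map_natCast, ← ha]
    rfl
  have hvw : E (MulEquiv.prodUnits.symm (v, w)) =
      i (v * m⁻¹) * E (MulEquiv.prodUnits.symm (m, w)) := by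
    change _ = E (MulEquiv.prodUnits.symm (v * m⁻¹, 1)) * _
    rw [← map_mul, ← map_mul, Prod.mk_mul_mk, inv_mul_cancel_right, one_mul]
  refine ⟨Additive.ofMul (v * m⁻¹), Subtype.ext ?_⟩
  change φ (Additive.ofMul (i (v * m⁻¹))) = φ (Additive.ofMul (E (MulEquiv.prodUnits.symm (v, w))))
  rw [hvw, ofMul_mul, map_add, hm, add_zero]

/-- `Aˣ` is cyclic of order `(p-1)(p+1)`. The kernel contains the units of the prime field and has
exponent dividing `2(p-1)`, so its order is `p-1` or `2(p-1)`; the range is cyclic and determined by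
its order. -/
theorem zmod_equiv_of_card_eq_sq {A : Type*} [Field A] (hA : Nat.card A = p ^ 2)
    (φ : Additive Aˣ →+ C)
    (hφ : ∀ (a : ℕ) (u : Aˣ), u.1 = a → φ (Additive.ofMul u) = 0)
    (hφ' : ∀ u : Aˣ, φ (Additive.ofMul u) = 0 → u ^ (2 * (p - 1)) = 1) :
    Nonempty (φ.range ≃+ ZMod (p + 1)) ∨ Nonempty (φ.range ≃+ ZMod ((p + 1) / 2)) := by
  have : Finite A := Nat.finite_of_card_ne_zero (hA ▸ pow_ne_zero 2 hp.out.ne_zero)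
  have : Fintype A := Fintype.ofFinite A
  have hp1 := hp.out.two_le
  have hchar : CharP A p := by
    obtain ⟨q, hq⟩ := CharP.exists A
    obtain ⟨n, hq', hn⟩ := FiniteField.card A q
    rw [← Nat.card_eq_fintype_card, hA] at hn
    have : p = q := (Nat.prime_dvd_prime_iff_eq hp.out hq').1
      (hp.out.dvd_of_dvd_pow (hn ▸ dvd_pow_self p two_ne_zero))
    rwa [this]
  have hcyc : IsAddCyclic φ.range := isAddCyclic_of_surjective φ.rangeRestrict
    φ.rangeRestrict_surjective
  have hcard : Nat.card φ.ker * Nat.card φ.range = (p - 1) * (p + 1) := by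
    rw [← AddSubgroup.index_ker, AddSubgroup.card_mul_index, Nat.card_congr Additive.toMul,
      Nat.card_units, hA, mul_comm, ← Nat.sq_sub_sq, one_pow]
  -- The kernel is cyclic, so a bound on its exponent is a bound on its order.
  have hdvd : Nat.card φ.ker ∣ (p - 1) * 2 := by
    rw [← IsAddCyclic.exponent_eq_card, mul_comm]
    exact AddMonoid.exponent_dvd_of_forall_nsmul_eq_zero fun x => Subtype.ext (hφ' x.1.toMul x.2)
  have hdvd' : p - 1 ∣ Nat.card φ.ker := by
    let ι : ZMod p →+* A := ZMod.castHom dvd_rfl A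
    let j : Additive (ZMod p)ˣ →+ Additive Aˣ := MonoidHom.toAdditive (Units.map ι.toMonoidHom)
    have hj : Function.Injective j := Units.map_injective ι.injective
    have hle : j.range ≤ φ.ker := by
      rintro _ ⟨u, rfl⟩
      obtain ⟨u, rfl⟩ := Additive.ofMul.surjective u
      refine hφ u.1.val _ ?_
      change ι u.1 = _
      rw [← map_natCast ι, ZMod.natCast_zmod_val]
    have h := AddSubgroup.card_dvd_of_le hle
    rwa [Nat.card_congr (AddMonoidHom.ofInjective hj).toEquiv.symm, Nat.card_congr Additive.toMul,
      Nat.card_units, Nat.card_zmod] at h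
  obtain ⟨k, hk⟩ := hdvd'
  have hp0 : 0 < p - 1 := by omega
  rw [hk] at hdvd hcard
  have hk2 : k ∣ 2 := Nat.dvd_of_mul_dvd_mul_left hp0 hdvd
  rw [mul_assoc] at hcard
  have hD := Nat.eq_of_mul_eq_mul_left hp0 hcard
  rcases (Nat.dvd_prime Nat.prime_two).1 hk2 with rfl | rfl
  · rw [one_mul] at hD
    exact Or.inl ⟨(hD ▸ zmodAddCyclicAddEquiv hcyc).symm⟩
  · have hD' : Nat.card φ.range = (p + 1) / 2 := by omega
    exact Or.inr ⟨(hD' ▸ zmodAddCyclicAddEquiv hcyc).symm⟩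

end finiteField

/-! ### The image of the units in `R / p`, and the conclusion. -/

namespace CyclicGroupRing

theorem natCast_quotient_span_eq_zero {R : Type*} [CommRing R] {p : ℕ} (a : ℕ) (h : p ∣ a) :
    (a : R ⧸ Ideal.span {(p : R)}) = 0 := by
  rw [← map_natCast (Ideal.Quotient.mk _), Ideal.Quotient.eq_zero_iff_mem,
    Ideal.mem_span_singleton]
  exact Nat.cast_dvd_cast h

variable {R : Type u} [CommRing R] {p : ℕ} [hp : Fact p.Prime] {G : Type v} [CommGroup G]
  [Fintype G]

/-- The units of `R / p` given by integers are images of units of `R[G] / (∑ g)`. -/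
theorem exists_of_eq_natCast [IsCyclic G] (hG : Nat.card G = p)
    [Nontrivial (R ⧸ Ideal.span {(p : R)})] (a : ℕ) (u : (R ⧸ Ideal.span {(p : R)})ˣ)
    (hu : u.1 = a) : ∃ (r : Rˣ) (x y : MonoidAlgebra R G), x * y - 1 ∈ Ideal.span {normElt R G} ∧
      Ideal.Quotient.mk _ (r : R) = Ideal.Quotient.mk _ (aug R G x) * u.1 := by
  obtain ⟨g, hg⟩ := IsCyclic.exists_generator (α := G)
  have ha : a.Coprime p := ((Nat.Prime.coprime_iff_not_dvd hp.out).2 fun h =>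
    u.ne_zero (hu.trans (natCast_quotient_span_eq_zero a h))).symm
  obtain ⟨b, -, hb⟩ := Nat.exists_mul_mod_eq_one_of_coprime ha hp.out.one_lt
  have hb' : b.Coprime p := by
    refine ((Nat.Prime.coprime_iff_not_dvd hp.out).2 fun h => ?_).symm
    rw [Nat.mod_eq_zero_of_dvd (h.mul_left a)] at hb
    exact zero_ne_one hb
  -- The cyclotomic unit is taken for the inverse `b` of `a` mod `p`, so that `aug x * u = 1` in `R
  -- / p` and `r = 1` works.
  obtain ⟨x, y, hxy, hx⟩ := exists_mul_sub_one_mem (k := R) hG hg hb'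
  refine ⟨1, x, y, hxy, ?_⟩
  have h := Nat.div_add_mod (a * b) p
  rw [hb] at h
  have h' := congrArg (Nat.cast : ℕ → R ⧸ Ideal.span {(p : R)}) h
  rw [Nat.cast_add, natCast_quotient_span_eq_zero _ (dvd_mul_right _ _), zero_add, Nat.cast_one,
    Nat.cast_mul] at h'
  rw [hx, hu, Units.val_one, map_one, map_natCast, h', mul_comm]

/-- Raise `r = aug x * u` to the power `2(p-1)`. Units of `R` square to `1`, and `(aug x)^(p-1)` is
congruent mod `p` to a unit of `R`, so only the power of `u` remains. -/
theorem pow_eq_one_of_forall_units (hG : Nat.card G = p)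
    (hR : ∀ r : Rˣ, (r : R) = 1 ∨ (r : R) = -1) (u : (R ⧸ Ideal.span {(p : R)})ˣ)
    (h : ∃ (r : Rˣ) (x y : MonoidAlgebra R G), x * y - 1 ∈ Ideal.span {normElt R G} ∧
      Ideal.Quotient.mk _ (r : R) = Ideal.Quotient.mk _ (aug R G x) * u.1) :
    u ^ (2 * (p - 1)) = 1 := by
  obtain ⟨r, x, y, hxy, h⟩ := h
  obtain ⟨s, c, hs⟩ := exists_unit_of_mul_sub_one_mem hG hxy
  have hsq : ∀ r : Rˣ, (r : R) ^ 2 = 1 := fun r => by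
    rcases hR r with h | h <;> rw [h] <;> simp
  have h1 : Ideal.Quotient.mk (Ideal.span {(p : R)}) (aug R G x) ^ (p - 1) =
      Ideal.Quotient.mk _ (s : R) := by
    rw [← map_pow, hs, map_add, Ideal.Quotient.eq_zero_iff_mem.2
      (Ideal.mul_mem_left _ c (Ideal.mem_span_singleton_self _)), add_zero]
  have h2 := congrArg (· ^ (2 * (p - 1))) h
  simp only [mul_pow] at h2
  rw [pow_mul, ← map_pow, hsq, map_one, one_pow, mul_comm 2, pow_mul _ (p - 1) 2, h1, ← map_pow,
    hsq, map_one, one_mul] at h2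
  ext
  rw [Units.val_pow_eq_pow_val, Units.val_one, h2, mul_comm]

end CyclicGroupRing

open CyclicGroupRing in
theorem proposition3p5 (d p : ℕ) (hd : 0 < d) (hsq : Squarefree d) (hd1 : d ≠ 1) (hd3 : d ≠ 3)
    (hp : p.Prime) (hp2 : p ≠ 2) (hdp : d.Coprime p)
    (K : Type u) [Field K] [NumberField K] (α : K) (hα : α ^ 2 = -(d : K))
    (hK : IntermediateField.adjoin ℚ {α} = ⊤)
    (G : Type v) [CommGroup G] [Finite G] [IsCyclic G] (hG : Nat.card G = p) :
    ((∃ P₁ P₂ : Ideal (𝓞 K), P₁.IsPrime ∧ P₂.IsPrime ∧ P₁ ≠ P₂ ∧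
        Ideal.span {(p : 𝓞 K)} = P₁ * P₂) →
      ∃ f : ZMod (p - 1) →+ KernelGroup (𝓞 K) K G, Function.Surjective f) ∧
    ((Ideal.span {(p : 𝓞 K)}).IsPrime →
      Nonempty (KernelGroup (𝓞 K) K G ≃+ ZMod (p + 1)) ∨
        Nonempty (KernelGroup (𝓞 K) K G ≃+ ZMod ((p + 1) / 2))) := by
  have : Fact p.Prime := ⟨hp⟩
  have : Fintype G := Fintype.ofFinite G
  have hp0 : (p : 𝓞 K) ≠ 0 := Nat.cast_ne_zero.2 hp.ne_zero
  have hspan : Ideal.span {(p : 𝓞 K)} ≠ ⊥ := by rwa [Ne, Ideal.span_singleton_eq_bot]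
  have hcard := ImaginaryQuadratic.natCard_quotient_span hd hα hK p
  constructor
  · rintro ⟨P₁, P₂, h₁, h₂, hne, hP⟩
    have hb₁ : P₁ ≠ ⊥ := by
      rintro rfl
      exact hspan (by rw [hP, Ideal.bot_mul])
    have hb₂ : P₂ ≠ ⊥ := by
      rintro rfl
      exact hspan (by rw [hP, Ideal.mul_bot])
    have hm₁ : P₁.IsMaximal := h₁.isMaximal hb₁
    have hm₂ : P₂.IsMaximal := h₂.isMaximal hb₂
    have hco : IsCoprime P₁ P₂ := Ideal.isCoprime_of_isMaximal hne
    let e := (Ideal.quotEquivOfEq hP).trans (Ideal.quotientMulEquivQuotientProd P₁ P₂ hco)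
    let _ : Field (𝓞 K ⧸ P₁) := Ideal.Quotient.field P₁
    let _ : Field (𝓞 K ⧸ P₂) := Ideal.Quotient.field P₂
    -- The two residue fields have orders greater than `1` with product `p²`, so each has `p`
    -- elements.
    rw [Nat.card_congr e.toEquiv, Nat.card_prod, hp.mul_eq_prime_sq_iff
      Finite.one_lt_card.ne' Finite.one_lt_card.ne'] at hcard
    have : Finite (𝓞 K ⧸ P₁) := Nat.finite_of_card_ne_zero (hcard.1 ▸ hp.ne_zero)
    obtain ⟨φ, hφ, hker⟩ := exists_kernelGroup_hom (R := 𝓞 K) (F := K) hG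
      (by rw [hP, Ideal.mul_eq_inf_of_isCoprime hco]; exact h₁.isRadical.inf h₂.isRadical)
      (((isDiagonalizableByTransvections_field (𝓞 K ⧸ P₁)).prod
        (isDiagonalizableByTransvections_field (𝓞 K ⧸ P₂))).of_surjective e.symm.toRingHom
        e.symm.surjective)
    rw [← hφ]
    refine exists_surjective_of_ringEquiv_prod e hcard.1 hcard.2 φ ?_
    have : Nontrivial (𝓞 K ⧸ Ideal.span {(p : 𝓞 K)}) := e.toEquiv.nontrivial
    exact fun a u hu => (hker u).2 (exists_of_eq_natCast hG a u hu)
  · intro hP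
    have hm := hP.isMaximal hspan
    let _ : Field (𝓞 K ⧸ Ideal.span {(p : 𝓞 K)}) := Ideal.Quotient.field _
    obtain ⟨φ, hφ, hker⟩ := exists_kernelGroup_hom (R := 𝓞 K) (F := K) hG hP.isRadical
      (isDiagonalizableByTransvections_field (𝓞 K ⧸ Ideal.span {(p : 𝓞 K)}))
    rw [← hφ]
    exact zmod_equiv_of_card_eq_sq hcard φ
      (fun a u hu => (hker u).2 (exists_of_eq_natCast hG a u hu))
      fun u hu => pow_eq_one_of_forall_units hG
        (ImaginaryQuadratic.units_eq_one_or_neg_one hd hsq hd1 hd3 hα hK) u ((hker u).1 hu)
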